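/- Let $k$ be a field. A standard graded $k$-algebra is a graded $k$-algebra $R=\bigoplus_{j\ge 0}R_j$ with $R_0=k$ that is generated over $k$ by finitely many forms of degree one; let $\mathfrak m=\bigoplus_{j\ge 1}R_j$. For a finitely generated graded $R$-module $M$ let $$\operatorname{reg} M=\max\{a(H^i_{\mathfrak m}(M))+i \mid i\ge 0\},$$ where $H^i_{\mathfrak m}(M)$ is the $i$-th (graded) local cohomology module of $M$ with respect to $\mathfrak m$, and $a(H)$ is the largest degree $j$ with $H_j\ne 0$ ($a(0)=-\infty$). If $I\subset R$ is an ideal generated by forms of degree $d$, the defect sequence of the function $\operatorname{reg} R/I^n$ is $a_n=\operatorname{reg} R/I^n-dn+1$, $n\ge 1$. **Theorem.** Let $k$ be any field, $d\ge 1$ and $r\ge 1$ integers. (1) Let $\{a_n\}_{n\ge 1}$ be a convergent (that is, eventually constant) sequence of non-negative integers with $a_n-a_{n+1}\le d$ for all $n\ge 1$. Then there are a standard graded $k$-algebra $R$ and a proper ideal $I$ of $R$ generated by forms of degree $d$, with $I^n\neq 0$ for all $n\ge 1$ and $\dim R/I=r$, such that $\{a_n\}$ is the defect sequence of the function $\operatorname{reg}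 R/I^n$, i.e. $\operatorname{reg} R/I^n=dn+a_n-1$ for all $n\ge 1$. (2) Equivalently, let $f$ be an integer-valued function on the integers $n\ge 1$ such that $f(n)\ge dn-1$ and $f(n)\le f(n+1)$ for all $n\ge 1$ and, for some integer $e$, $f(n)=dn+e$ for all sufficiently large $n$. Then there are $R$ and $I$ as in (1) with $\operatorname{reg} R/I^n=f(n)$ for all $n\ge 1$. -/

import Mathlib

open Filter Topology

universe u v

noncomputable section

namespace GradedReg

section Cech

variable {R : Type u} [CommRing R] {s : ℕ} (x : Fin s → R)

/-- The product `x_T` of the elements `x l`, `l ∈ T`. -/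
def cechProd (T : Finset (Fin s)) : R := ∏ l ∈ T, x l

variable (M : Type v) [AddCommGroup M] [Module R M]

/-- The localization `M_{x_T}` of the module `M` at the powers of `x_T`. -/
def CechLoc (T : Finset (Fin s)) : Type (max u v) :=
  LocalizedModule (Submonoid.powers (cechProd x T)) M

instance (T : Finset (Fin s)) : AddCommGroup (CechLoc x M T) :=
  inferInstanceAs (AddCommGroup (LocalizedModule (Submonoid.powers (cechProd x T)) M))

instance (T : Finset (Fin s)) : Module R (CechLoc x M T) :=
  inferInstanceAs (Module R (LocalizedModule (Submonoid.powers (cechProd x T)) M))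

/-- The localization map `M → M_{x_T}`. -/
def cechOf (T : Finset (Fin s)) : M →ₗ[R] CechLoc x M T :=
  LocalizedModule.mkLinearMap (Submonoid.powers (cechProd x T)) M

instance (T : Finset (Fin s)) :
    IsLocalizedModule (Submonoid.powers (cechProd x T)) (cechOf x M T) :=
  inferInstanceAs (IsLocalizedModule (Submonoid.powers (cechProd x T))
    (LocalizedModule.mkLinearMap (Submonoid.powers (cechProd x T)) M))

theorem isUnit_of_subset {T T' : Finset (Fin s)} (h : T ⊆ T')
    (a : Submonoid.powers (cechProd x T)) :
    IsUnit (algebraMap R (Module.End R (CechLoc x M T')) a) := by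
  obtain ⟨_, n, rfl⟩ := a
  have hu : IsUnit (algebraMap R (Module.End R (CechLoc x M T')) (cechProd x T')) :=
    IsLocalizedModule.map_units (cechOf x M T') ⟨cechProd x T', Submonoid.mem_powers _⟩
  obtain ⟨c, hc⟩ : cechProd x T ∣ cechProd x T' := Finset.prod_dvd_prod_of_subset _ _ _ h
  change IsUnit (algebraMap R (Module.End R (CechLoc x M T')) (cechProd x T ^ n))
  rw [map_pow]
  refine IsUnit.pow n ?_
  rw [hc, map_mul] at hu
  have hcomm : Commute (algebraMap R (Module.End R (CechLoc x M T')) (cechProd x T))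
      (algebraMap R (Module.End R (CechLoc x M T')) c) := Algebra.commutes _ _
  exact (hcomm.isUnit_mul_iff.mp hu).1

/-- The canonical map `M_{x_T} → M_{x_{T'}}` for `T ⊆ T'`. -/
def cechRes {T T' : Finset (Fin s)} (h : T ⊆ T') : CechLoc x M T →ₗ[R] CechLoc x M T' :=
  IsLocalizedModule.lift (Submonoid.powers (cechProd x T)) (cechOf x M T) (cechOf x M T')
    (isUnit_of_subset x M h)

/-- The `i`-th term `∏_{|T| = i} M_{x_T}` of the Čech complex of `M` with respect to `x`. -/
abbrev CechCochain (i : ℕ) : Type (max u v) :=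
  (T : {T : Finset (Fin s) // T.card = i}) → CechLoc x M T.1

/-- The Čech differential
`(dφ)_T = ∑_{l ∈ T} (-1)^{#{l' ∈ T | l' < l}} φ_{T \ {l}}`. -/
def cechD (i : ℕ) : CechCochain x M i →ₗ[R] CechCochain x M (i + 1) :=
  LinearMap.pi fun T => ∑ l : {l // l ∈ T.1},
    ((-1 : R) ^ (T.1.filter (· < l.1)).card) •
      ((cechRes x M (Finset.erase_subset l.1 T.1)).comp
        (LinearMap.proj (R := R)
          (φ := fun T : {T : Finset (Fin s) // T.card = i} => CechLoc x M T.1)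
          ⟨T.1.erase l.1, by rw [Finset.card_erase_of_mem l.2, T.2]; rfl⟩))

/-- The Čech cocycles. -/
def cechZ (i : ℕ) : Submodule R (CechCochain x M i) := LinearMap.ker (cechD x M i)

/-- The Čech coboundaries. -/
def cechB : (i : ℕ) → Submodule R (CechCochain x M i)
  | 0 => ⊥
  | i + 1 => LinearMap.range (cechD x M i)

/-- The `i`-th cohomology of the Čech complex of `M` with respect to `x`.  Over a Noetherian ring
this is the `i`-th local cohomology module `H^i_𝔪(M)`, `𝔪` being the ideal generated by `x`. -/
def LocalCohomology (i : ℕ) : Type (max u v) :=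
  cechZ x M i ⧸ (cechB x M i).comap (cechZ x M i).subtype

instance (i : ℕ) : AddCommGroup (LocalCohomology x M i) :=
  inferInstanceAs (AddCommGroup (cechZ x M i ⧸ (cechB x M i).comap (cechZ x M i).subtype))

instance (i : ℕ) : Module R (LocalCohomology x M i) :=
  inferInstanceAs (Module R (cechZ x M i ⧸ (cechB x M i).comap (cechZ x M i).subtype))

/-- The class of a cocycle. -/
def cechClass (i : ℕ) : cechZ x M i →ₗ[R] LocalCohomology x M i :=
  Submodule.mkQ ((cechB x M i).comap (cechZ x M i).subtype)

variable {M}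

/-- If the `x l` have degree one, an element `z` of `M_{x_T}` is homogeneous of degree `j` when it
is a fraction `m / x_T ^ t` with `m` homogeneous of degree `j + t * |T|`. -/
def IsHomogeneousLoc (𝓜 : ℤ → AddSubgroup M) (T : Finset (Fin s)) (j : ℤ)
    (z : CechLoc x M T) : Prop :=
  ∃ (t : ℕ) (m : M), m ∈ 𝓜 (j + t * T.card) ∧ cechProd x T ^ t • z = cechOf x M T m

/-- The degree `j` part of `H^i_𝔪(M)`: the classes of the cocycles all of whose components are
homogeneous of degree `j`. -/
def localCohomologyPiece (𝓜 : ℤ → AddSubgroup M) (i : ℕ) (j : ℤ) : Set (LocalCohomology x M i) :=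
  cechClass x M i '' {z | ∀ T : {T : Finset (Fin s) // T.card = i},
    IsHomogeneousLoc x 𝓜 T.1 j ((z : CechCochain x M i) T)}

/-- `reg M = e`: the integer `e` is the maximum of `a(H^i_𝔪(M)) + i` over all `i ≥ 0`, where `a(H)`
is the largest degree `j` with `H_j ≠ 0`. -/
def IsRegularity (𝓜 : ℤ → AddSubgroup M) (e : ℤ) : Prop :=
  IsGreatest {e : ℤ | ∃ (i : ℕ) (j : ℤ),
    (∃ h ∈ localCohomologyPiece x 𝓜 i j, h ≠ 0) ∧ e = j + i} e

end Cech

section Algebras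

variable {k : Type u} [Field k] {R : Type v} [CommRing R] [Algebra k R]

/-- A graded `k`-algebra is standard graded, with `x` a finite system of generators consisting of
forms of degree one.  (In particular the degree zero part is `k`, and the maximal graded ideal is
generated by `x`.) -/
structure IsStandardGradedBy (𝒜 : ℕ → Submodule k R) [GradedAlgebra 𝒜] {s : ℕ}
    (x : Fin s → R) : Prop where
  mem_one : ∀ l, x l ∈ 𝒜 1
  adjoin_eq_top : Algebra.adjoin k (Set.range x) = ⊤

/-- The ideal `I` is generated by forms of degree `d`. -/
def IsGeneratedInDegree (𝒜 : ℕ → Submodule k R) (I : Ideal R) (d : ℕ) : Prop :=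
  ∃ G : Set R, G ⊆ (𝒜 d : Set R) ∧ I = Ideal.span G

/-- The grading induced on `R ⧸ J`, indexed by `ℤ` (zero in negative degrees). -/
def quotientGrading (𝒜 : ℕ → Submodule k R) (J : Ideal R) : ℤ → AddSubgroup (R ⧸ J)
  | Int.ofNat j => (𝒜 j).toAddSubgroup.map (Ideal.Quotient.mk J).toAddMonoidHom
  | Int.negSucc _ => ⊥

end Algebras

/-- There are a standard graded `k`-algebra `R` and an ideal `I` of `R` generated by forms of
degree `d`, all of whose powers are nonzero, such that `dim R/I = r` and `reg R/I^n = f n` for all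
`n ≥ 1`. -/
def IsRegFunctionOfPowers (k : Type u) [Field k] (d r : ℕ) (f : ℕ → ℤ) : Prop :=
  ∃ (R : Type u) (_ : CommRing R) (_ : Algebra k R) (𝒜 : ℕ → Submodule k R)
    (_ : GradedAlgebra 𝒜) (s : ℕ) (x : Fin s → R) (I : Ideal R),
    IsStandardGradedBy 𝒜 x ∧
    IsGeneratedInDegree 𝒜 I d ∧
    (∀ n : ℕ, 1 ≤ n → I ^ n ≠ ⊥) ∧
    ringKrullDim (R ⧸ I) = r ∧
    ∀ n : ℕ, 1 ≤ n → IsRegularity x (quotientGrading 𝒜 (I ^ n)) (f n)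

end GradedReg

end

/-! Part (1) is part (2) for `f n = d n + a n - 1`: the bound on `a n - a (n + 1)` says that `f` is
nondecreasing, and `a n ≥ 0` says that `f n ≥ d n - 1`.

For (2), write `F` for the values of `f` and let `a` be constant from `N + 1` on. Take the quotient
of `k[y_1, …, y_r, x_0, …, x_N]` by monomials that include all `x_c x_c'` with `c ≠ c'`. Over `k[y]`
it splits into `k[y]` and one "chain" for each `c`, spanned by the monomials in which `x_c` is the
only `x` that occurs. The ideal `I` is generated by the `x_c ^ d` with `c ≠ 0`; mixed products
vanish, so passing modulo `I ^ n` just cuts these chains at exponent `d n` (`powIdeal_pow`).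

A chain with `0 < c < N` is free over `k[y]` below the exponent `d (c + 1) - 1`, carries `k[y] / (y)
^ (a (c + 1) + 1)` at that exponent, and then stops. While `n ≤ c` only its free part survives, of
regularity at most `d n - 1 ≤ F n`. From `n = c + 1` on it contributes exactly `F (c + 1)`, which is
harmless later because `F` is nondecreasing. The chain `N` never stops in `R`, so its last surviving
layer modulo `I ^ n` gives `d n - 1 + a (N + 1) = F n` for all `n > N`. The chain `0` is killed by
the `y_l`, avoids `I`, and supplies `F 1`.

The upper bound `regLE_chainSet` rests on two facts: a kernel living in degrees at most `e` does not
spoil the bound `e` (`RegLE.of_map`), and a nonzerodivisor of degree one may be divided out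
(`RegLE.of_smul_regular`). The bound is attained by a socle monomial (`exists_socle_class`) or, when
`F 1 = 0`, by the top local cohomology of `k[y]` (`exists_top_class`). -/

noncomputable section

namespace GradedReg

/-! ### The Čech differential on families indexed by all subsets -/

section CechFamilies

variable {R : Type u} [CommRing R] {s : ℕ} (x : Fin s → R)
variable {M : Type v} [AddCommGroup M] [Module R M]
variable {N : Type v} [AddCommGroup N] [Module R N]

/-- The basic tool for identities between fractions: they may be checked after clearing
denominators. -/
theorem cechProd_smul_injective {T T' : Finset (Fin s)} (h : T ⊆ T') (t : ℕ) :
    Function.Injective fun z : CechLoc x M T' => cechProd x T ^ t • z :=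
  ((Module.End.isUnit_iff _).mp (isUnit_of_subset x M h ⟨_, t, rfl⟩)).injective

theorem exists_cechOf_eq (T : Finset (Fin s)) (z : CechLoc x M T) :
    ∃ (t : ℕ) (m : M), cechProd x T ^ t • z = cechOf x M T m := by
  obtain ⟨⟨m, ⟨_, t, rfl⟩⟩, h⟩ :=
    IsLocalizedModule.surj (Submonoid.powers (cechProd x T)) (cechOf x M T) z
  exact ⟨t, m, h⟩

theorem cechOf_eq_zero_iff (T : Finset (Fin s)) (m : M) :
    cechOf x M T m = 0 ↔ ∃ t : ℕ, cechProd x T ^ t • m = 0 := by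
  rw [IsLocalizedModule.eq_zero_iff (Submonoid.powers (cechProd x T)) (cechOf x M T)]
  constructor
  · rintro ⟨⟨_, t, rfl⟩, h⟩
    exact ⟨t, h⟩
  · rintro ⟨t, h⟩
    exact ⟨⟨_, t, rfl⟩, h⟩

/-- The fraction `m / x_T ^ t`. -/
def cechFrac (T : Finset (Fin s)) (t : ℕ) (m : M) : CechLoc x M T :=
  IsLocalizedModule.mk' (cechOf x M T) m (⟨_, t, rfl⟩ : Submonoid.powers (cechProd x T))

theorem smul_cechFrac (T : Finset (Fin s)) (t : ℕ) (m : M) :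
    cechProd x T ^ t • cechFrac x T t m = cechOf x M T m :=
  IsLocalizedModule.mk'_cancel' (cechOf x M T) m
    (⟨_, t, rfl⟩ : Submonoid.powers (cechProd x T))

theorem cechRes_cechOf {T T' : Finset (Fin s)} (h : T ⊆ T') (m : M) :
    cechRes x M h (cechOf x M T m) = cechOf x M T' m :=
  IsLocalizedModule.lift_apply _ _ _ _ _

theorem cechRes_trans {T T' T'' : Finset (Fin s)} (h : T ⊆ T') (h' : T' ⊆ T'')
    (z : CechLoc x M T) :
    cechRes x M h' (cechRes x M h z) = cechRes x M (h.trans h') z := by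
  obtain ⟨t, m, hm⟩ := exists_cechOf_eq x T z
  apply cechProd_smul_injective x (h.trans h') t
  simp only [← map_smul, hm, cechRes_cechOf]

/-- The two values of `z` have different types, so an equality of index sets cannot simply be
rewritten. -/
theorem cechRes_congr (z : ∀ T, CechLoc x M T) {T T' T'' : Finset (Fin s)} (e : T = T')
    (h : T ⊆ T'') (h' : T' ⊆ T'') :
    cechRes x M h (z T) = cechRes x M h' (z T') := by
  subst e; rfl

/-- The map `M_{x_T} → N_{x_T}` induced by `f : M → N`. -/
def cechMap (f : M →ₗ[R] N) (T : Finset (Fin s)) : CechLoc x M T →ₗ[R] CechLoc x N T :=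
  IsLocalizedModule.map (Submonoid.powers (cechProd x T)) (cechOf x M T) (cechOf x N T) f

theorem cechMap_cechOf (f : M →ₗ[R] N) (T : Finset (Fin s)) (m : M) :
    cechMap x f T (cechOf x M T m) = cechOf x N T (f m) :=
  IsLocalizedModule.map_apply _ _ _ _ _

theorem cechMap_cechRes (f : M →ₗ[R] N) {T T' : Finset (Fin s)} (h : T ⊆ T')
    (z : CechLoc x M T) :
    cechMap x f T' (cechRes x M h z) = cechRes x N h (cechMap x f T z) := by
  obtain ⟨t, m, hm⟩ := exists_cechOf_eq x T z
  apply cechProd_smul_injective x h t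
  simp only [← map_smul, hm, cechRes_cechOf, cechMap_cechOf]

/-- The sign `(-1)^{#{l' ∈ T | l' < l}}` of the Čech differential. -/
def cechSign (R : Type u) [CommRing R] (l : Fin s) (T : Finset (Fin s)) : R :=
  (-1 : R) ^ (T.filter (· < l)).card

theorem cechSign_mul_self (l : Fin s) (T : Finset (Fin s)) :
    cechSign R l T * cechSign R l T = 1 := by
  rw [cechSign, ← pow_add, ← two_mul, pow_mul]; simp

theorem cechSign_erase_self (l : Fin s) (T : Finset (Fin s)) :
    cechSign R l (T.erase l) = cechSign R l T := by
  unfold cechSign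
  congr 2
  ext a
  simp only [Finset.mem_filter, Finset.mem_erase]
  constructor
  · rintro ⟨⟨_, h⟩, h'⟩; exact ⟨h, h'⟩
  · rintro ⟨h, h'⟩; exact ⟨⟨h'.ne, h⟩, h'⟩

theorem cechSign_erase_of_lt {l l' : Fin s} {T : Finset (Fin s)} (h' : l' ∈ T) (hlt : l' < l) :
    cechSign R l (T.erase l') = - cechSign R l T := by
  unfold cechSign
  have hmem : l' ∈ T.filter (· < l) := by simp [h', hlt]
  rw [Finset.filter_erase, ← Finset.card_erase_add_one hmem, pow_succ]
  ring

theorem cechSign_erase_of_gt {l l' : Fin s} {T : Finset (Fin s)} (hlt : l < l') :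
    cechSign R l (T.erase l') = cechSign R l T := by
  unfold cechSign
  rw [Finset.filter_erase, Finset.erase_eq_of_notMem]
  simp [hlt.le]

/-- Removing the smaller of two indices flips the sign of the larger one and not conversely. -/
theorem cechSign_swap {l l' : Fin s} {T : Finset (Fin s)} (h : l ∈ T) (h' : l' ∈ T)
    (hne : l ≠ l') :
    cechSign R l T * cechSign R l' (T.erase l) =
      -(cechSign R l' T * cechSign R l (T.erase l')) := by
  rcases lt_or_gt_of_ne hne with hlt | hlt
  · rw [cechSign_erase_of_lt h hlt, cechSign_erase_of_gt hlt]; ring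
  · rw [cechSign_erase_of_lt h' hlt, cechSign_erase_of_gt hlt]; ring

/-- The Čech differential on families indexed by all subsets of the index set. -/
def famD (z : ∀ T, CechLoc x M T) (T : Finset (Fin s)) : CechLoc x M T :=
  ∑ l ∈ T, cechSign R l T • cechRes x M (Finset.erase_subset l T) (z (T.erase l))

theorem famD_sub (z w : ∀ T, CechLoc x M T) (T : Finset (Fin s)) :
    famD x (fun T => z T - w T) T = famD x z T - famD x w T := by
  simp [famD, smul_sub, Finset.sum_sub_distrib]

theorem famD_smul (a : R) (z : ∀ T, CechLoc x M T) (T : Finset (Fin s)) :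
    famD x (fun T => a • z T) T = a • famD x z T := by
  simp only [famD, Finset.smul_sum, map_smul]
  exact Finset.sum_congr rfl fun l _ => smul_comm _ _ _

theorem famD_congr {z w : ∀ T, CechLoc x M T} {T : Finset (Fin s)}
    (h : ∀ l ∈ T, z (T.erase l) = w (T.erase l)) : famD x z T = famD x w T :=
  Finset.sum_congr rfl fun l hl => by rw [h l hl]

theorem cechMap_famD (f : M →ₗ[R] N) (z : ∀ T, CechLoc x M T) (T : Finset (Fin s)) :
    cechMap x f T (famD x z T) = famD x (fun T => cechMap x f T (z T)) T := by
  simp only [famD, map_sum, map_smul, cechMap_cechRes]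

/-- The terms that remove `l, l'` in the two possible orders cancel by `cechSign_swap`. -/
theorem famD_famD (z : ∀ T, CechLoc x M T) (T : Finset (Fin s)) :
    famD x (famD x z) T = 0 := by
  have key : famD x (famD x z) T = ∑ p ∈ T.offDiag,
      (cechSign R p.1 T * cechSign R p.2 (T.erase p.1)) •
        cechRes x M (((T.erase p.1).erase_subset p.2).trans (T.erase_subset p.1))
          (z ((T.erase p.1).erase p.2)) := by
    have e : T.offDiag = (T.sigma fun l => T.erase l).map
        ⟨fun p => (p.1, p.2), fun p q h => by cases p; cases q; simpa using h⟩ := by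
      ext ⟨a, b⟩
      simp only [Finset.mem_offDiag, Finset.mem_map, Finset.mem_sigma, Finset.mem_erase,
        Sigma.exists]
      constructor
      · rintro ⟨h1, h2, h3⟩; exact ⟨a, b, ⟨h1, Ne.symm h3, h2⟩, rfl⟩
      · rintro ⟨a, b, ⟨h1, h3, h2⟩, h⟩; cases h; exact ⟨h1, h2, Ne.symm h3⟩
    rw [e, Finset.sum_map, Finset.sum_sigma]
    refine Finset.sum_congr rfl fun l _ => ?_
    simp only [famD, map_sum, map_smul, Finset.smul_sum, cechRes_trans, smul_smul]
    rfl
  rw [key]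
  refine Finset.sum_involution (fun p _ => p.swap) ?_ ?_ ?_ ?_
  · rintro ⟨a, b⟩ hp
    obtain ⟨h1, h2, h3⟩ := Finset.mem_offDiag.mp hp
    simp only [Prod.swap]
    rw [cechSign_swap h1 h2 h3, neg_smul, neg_add_eq_zero]
    congr 1
    exact cechRes_congr x z Finset.erase_right_comm _ _
  · rintro ⟨a, b⟩ hp _ h
    obtain ⟨h1, h2, h3⟩ := Finset.mem_offDiag.mp hp
    simp only [Prod.swap, Prod.mk.injEq] at h
    exact h3 h.2
  · rintro ⟨a, b⟩ hp
    obtain ⟨h1, h2, h3⟩ := Finset.mem_offDiag.mp hp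
    exact Finset.mem_offDiag.mpr ⟨h2, h1, Ne.symm h3⟩
  · rintro ⟨a, b⟩ hp
    rfl

/-- The extension of a cochain by zero to a family indexed by all subsets. -/
def cochainFam {i : ℕ} (z : CechCochain x M i) (T : Finset (Fin s)) : CechLoc x M T :=
  if h : T.card = i then z ⟨T, h⟩ else 0

theorem cochainFam_of_card {i : ℕ} (z : CechCochain x M i)
    (T : {T : Finset (Fin s) // T.card = i}) : cochainFam x z T.1 = z T := by
  simp [cochainFam, T.2]

/-- The bridge to the complex of the definition; families over all `T` avoid carrying cardinality
proofs in the indices. -/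
theorem cechD_apply {i : ℕ} (z : CechCochain x M i)
    (T : {T : Finset (Fin s) // T.card = i + 1}) :
    cechD x M i z T = famD x (cochainFam x z) T.1 := by
  rw [famD, ← Finset.sum_coe_sort]
  simp only [cechD, LinearMap.pi_apply, LinearMap.sum_apply, LinearMap.smul_apply,
    LinearMap.comp_apply, LinearMap.proj_apply]
  refine Finset.sum_congr rfl fun l _ => ?_
  have hc : (T.1.erase l.1).card = i := by rw [Finset.card_erase_of_mem l.2, T.2]; rfl
  rw [show cochainFam x z (T.1.erase l.1) = z ⟨_, hc⟩ from cochainFam_of_card x z ⟨_, hc⟩]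
  rfl

end CechFamilies

/-! ### Homogeneous cochains and upper bounds for the regularity -/

section Homogeneous

variable {R : Type u} [CommRing R] {s : ℕ} (x : Fin s → R)
variable {M : Type v} [AddCommGroup M] [Module R M] (𝓜 : ℤ → AddSubgroup M)
variable {N : Type v} [AddCommGroup N] [Module R N] (𝓖 : ℤ → AddSubgroup N)

/-- Multiplication by the `x l` raises degrees by one. -/
def IsGradedBy : Prop := ∀ (l : Fin s) (j : ℤ) (m : M), m ∈ 𝓜 j → x l • m ∈ 𝓜 (j + 1)

variable {𝓜 𝓖}

theorem IsGradedBy.cechProd_smul_mem (h𝓜 : IsGradedBy x 𝓜) (T : Finset (Fin s)) {j : ℤ} {m : M}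
    (hm : m ∈ 𝓜 j) : cechProd x T • m ∈ 𝓜 (j + T.card) := by
  induction T using Finset.induction_on with
  | empty => simpa [cechProd] using hm
  | insert l T hl ih =>
    rw [cechProd, Finset.prod_insert hl, mul_smul, Finset.card_insert_of_notMem hl]
    have := h𝓜 l _ _ ih
    rwa [add_assoc, ← Nat.cast_succ] at this

theorem IsGradedBy.cechProd_pow_smul_mem (h𝓜 : IsGradedBy x 𝓜) (T : Finset (Fin s)) (t : ℕ)
    {j : ℤ} {m : M} (hm : m ∈ 𝓜 j) : cechProd x T ^ t • m ∈ 𝓜 (j + t * T.card) := by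
  induction t with
  | zero => simpa using hm
  | succ t ih =>
    rw [pow_succ', mul_smul]
    have := h𝓜.cechProd_smul_mem x T ih
    rwa [show j + t * (T.card : ℤ) + T.card = j + ((t + 1 : ℕ) : ℤ) * T.card by
      push_cast; ring] at this

/-- The denominator of a homogeneous fraction may be enlarged. -/
theorem IsHomogeneousLoc.exists_of_le (h𝓜 : IsGradedBy x 𝓜) {T : Finset (Fin s)} {j : ℤ}
    {z : CechLoc x M T} (hz : IsHomogeneousLoc x 𝓜 T j z) :
    ∃ t₀ : ℕ, ∀ t, t₀ ≤ t → ∃ m ∈ 𝓜 (j + t * T.card), cechProd x T ^ t • z = cechOf x M T m := by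
  obtain ⟨t₀, m, hm, h⟩ := hz
  refine ⟨t₀, fun t ht => ?_⟩
  obtain ⟨c, rfl⟩ := Nat.exists_eq_add_of_le ht
  refine ⟨cechProd x T ^ c • m, ?_, ?_⟩
  · have := h𝓜.cechProd_pow_smul_mem x T c hm
    convert this using 2
    push_cast; ring
  · rw [add_comm, pow_add, mul_smul, h, map_smul]

/-- A common denominator exponent for a homogeneous family. -/
theorem exists_uniform_exponent (h𝓜 : IsGradedBy x 𝓜) {j : ℤ} {z : ∀ T, CechLoc x M T}
    (hz : ∀ T, IsHomogeneousLoc x 𝓜 T j (z T)) :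
    ∃ t : ℕ, ∀ T : Finset (Fin s), ∃ m ∈ 𝓜 (j + t * T.card),
      cechProd x T ^ t • z T = cechOf x M T m := by
  choose t₀ ht₀ using fun T => (hz T).exists_of_le x h𝓜
  exact ⟨Finset.univ.sup t₀, fun T => ht₀ T _ (Finset.le_sup (Finset.mem_univ T))⟩

theorem IsHomogeneousLoc.zero (T : Finset (Fin s)) (j : ℤ) :
    IsHomogeneousLoc x 𝓜 T j (0 : CechLoc x M T) :=
  ⟨0, 0, zero_mem _, by simp⟩

theorem IsHomogeneousLoc.add (h𝓜 : IsGradedBy x 𝓜) {T : Finset (Fin s)} {j : ℤ}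
    {z w : CechLoc x M T} (hz : IsHomogeneousLoc x 𝓜 T j z) (hw : IsHomogeneousLoc x 𝓜 T j w) :
    IsHomogeneousLoc x 𝓜 T j (z + w) := by
  obtain ⟨t₁, h₁⟩ := hz.exists_of_le x h𝓜
  obtain ⟨t₂, h₂⟩ := hw.exists_of_le x h𝓜
  obtain ⟨m, hm, e⟩ := h₁ _ (le_max_left t₁ t₂)
  obtain ⟨m', hm', e'⟩ := h₂ _ (le_max_right t₁ t₂)
  exact ⟨max t₁ t₂, m + m', add_mem hm hm', by rw [smul_add, e, e', map_add]⟩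

theorem IsHomogeneousLoc.neg {T : Finset (Fin s)} {j : ℤ}
    {z : CechLoc x M T} (hz : IsHomogeneousLoc x 𝓜 T j z) :
    IsHomogeneousLoc x 𝓜 T j (-z) := by
  obtain ⟨t, m, hm, e⟩ := hz
  exact ⟨t, -m, neg_mem hm, by rw [smul_neg, e, map_neg]⟩

theorem IsHomogeneousLoc.sub (h𝓜 : IsGradedBy x 𝓜) {T : Finset (Fin s)} {j : ℤ}
    {z w : CechLoc x M T} (hz : IsHomogeneousLoc x 𝓜 T j z) (hw : IsHomogeneousLoc x 𝓜 T j w) :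
    IsHomogeneousLoc x 𝓜 T j (z - w) := by
  rw [sub_eq_add_neg]; exact hz.add x h𝓜 (hw.neg x)

theorem IsHomogeneousLoc.sign_smul {T : Finset (Fin s)} {j : ℤ} {z : CechLoc x M T}
    (hz : IsHomogeneousLoc x 𝓜 T j z) (l : Fin s) (T' : Finset (Fin s)) :
    IsHomogeneousLoc x 𝓜 T j (cechSign R l T' • z) := by
  rcases neg_one_pow_eq_or R (T'.filter (· < l)).card with h | h
  · rw [cechSign, h, one_smul]; exact hz
  · rw [cechSign, h, neg_smul, one_smul]; exact hz.neg x

theorem IsHomogeneousLoc.res (h𝓜 : IsGradedBy x 𝓜) {T T' : Finset (Fin s)} (h : T ⊆ T') {j : ℤ}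
    {z : CechLoc x M T} (hz : IsHomogeneousLoc x 𝓜 T j z) :
    IsHomogeneousLoc x 𝓜 T' j (cechRes x M h z) := by
  obtain ⟨t, m, hm, e⟩ := hz
  refine ⟨t, cechProd x (T' \ T) ^ t • m, ?_, ?_⟩
  · have := h𝓜.cechProd_pow_smul_mem x (T' \ T) t hm
    convert this using 2
    rw [← Finset.card_sdiff_add_card_eq_card h]
    push_cast; ring
  · have hp : cechProd x T' = cechProd x (T' \ T) * cechProd x T :=
      (Finset.prod_sdiff h).symm
    rw [hp, mul_pow, mul_smul, ← map_smul, e, cechRes_cechOf, map_smul]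

theorem IsHomogeneousLoc.famD (h𝓜 : IsGradedBy x 𝓜) {j : ℤ} {z : ∀ T, CechLoc x M T}
    (hz : ∀ T, IsHomogeneousLoc x 𝓜 T j (z T)) (T : Finset (Fin s)) :
    IsHomogeneousLoc x 𝓜 T j (famD x z T) := by
  unfold GradedReg.famD
  refine Finset.sum_induction _ (IsHomogeneousLoc x 𝓜 T j) (fun _ _ h h' => h.add x h𝓜 h')
    (.zero x T j) fun l _ => ?_
  exact ((hz _).res x h𝓜 _).sign_smul x _ _

theorem IsHomogeneousLoc.map {f : M →ₗ[R] N} (hf : ∀ j, ∀ m ∈ 𝓜 j, f m ∈ 𝓖 j)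
    {T : Finset (Fin s)} {j : ℤ} {z : CechLoc x M T} (hz : IsHomogeneousLoc x 𝓜 T j z) :
    IsHomogeneousLoc x 𝓖 T j (cechMap x f T z) := by
  obtain ⟨t, m, hm, e⟩ := hz
  exact ⟨t, f m, hf _ _ hm, by rw [← map_smul, e, cechMap_cechOf]⟩

/-- It suffices to lift the numerator, keeping the denominator. -/
theorem IsHomogeneousLoc.exists_lift {f : M →ₗ[R] N} (hf : ∀ j, ∀ n ∈ 𝓖 j, ∃ m ∈ 𝓜 j, f m = n)
    {T : Finset (Fin s)} {j : ℤ} {z : CechLoc x N T} (hz : IsHomogeneousLoc x 𝓖 T j z) :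
    ∃ w : CechLoc x M T, IsHomogeneousLoc x 𝓜 T j w ∧ cechMap x f T w = z := by
  obtain ⟨t, n, hn, e⟩ := hz
  obtain ⟨m, hm, rfl⟩ := hf _ _ hn
  refine ⟨cechFrac x T t m, ⟨t, m, hm, smul_cechFrac x T t m⟩, ?_⟩
  apply cechProd_smul_injective x subset_rfl t
  simp only [← map_smul, e, smul_cechFrac, cechMap_cechOf]

/-- A homogeneous fraction which dies in `N_{x_T}` is a fraction whose numerator dies in `N`. -/
theorem IsHomogeneousLoc.exists_of_cechMap_eq_zero (h𝓜 : IsGradedBy x 𝓜) (f : M →ₗ[R] N)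
    {T : Finset (Fin s)} {j : ℤ} {z : CechLoc x M T} (hz : IsHomogeneousLoc x 𝓜 T j z)
    (h0 : cechMap x f T z = 0) :
    ∃ (t : ℕ) (m : M), m ∈ 𝓜 (j + t * T.card) ∧ cechProd x T ^ t • z = cechOf x M T m ∧
      f m = 0 := by
  obtain ⟨t, m, hm, e⟩ := hz
  have h1 : cechOf x N T (f m) = 0 := by rw [← cechMap_cechOf, ← e, map_smul, h0, smul_zero]
  obtain ⟨c, hc⟩ := (cechOf_eq_zero_iff x T _).mp h1
  refine ⟨t + c, cechProd x T ^ c • m, ?_, ?_, by rw [map_smul, hc]⟩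
  · have := h𝓜.cechProd_pow_smul_mem x T c hm
    convert this using 2
    push_cast; ring
  · rw [add_comm, pow_add, mul_smul, e, map_smul]

variable (𝓜) in
/-- In cohomological degree `i` and internal degree `j` with `i + j > e`, homogeneous Čech
cocycles are coboundaries of homogeneous cochains. -/
def RegLE (e : ℤ) : Prop :=
  ∀ (i : ℕ) (j : ℤ), e < i + j → ∀ z : ∀ T, CechLoc x M T,
    (∀ T, IsHomogeneousLoc x 𝓜 T j (z T)) →
    (∀ T : Finset (Fin s), T.card = i + 1 → famD x z T = 0) →
    ∃ w : ∀ T, CechLoc x M T, (∀ T, IsHomogeneousLoc x 𝓜 T j (w T)) ∧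
      ∀ T : Finset (Fin s), T.card = i → z T = famD x w T

theorem RegLE.of_subsingleton [Subsingleton M] (e : ℤ) : RegLE x 𝓜 e := by
  intro i j _ z _ _
  refine ⟨fun _ => 0, fun T => .zero x T j, fun T _ => ?_⟩
  obtain ⟨t, m, h⟩ := exists_cechOf_eq x T (z T)
  apply cechProd_smul_injective x subset_rfl t
  simp [h, Subsingleton.elim m 0, famD]

/-- Regularity bounds pass from `N` to `M` along a surjection whose kernel lives in degrees at
most the bound. -/
theorem RegLE.of_map (h𝓜 : IsGradedBy x 𝓜) (f : M →ₗ[R] N) (hf : ∀ j, ∀ m ∈ 𝓜 j, f m ∈ 𝓖 j)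
    (hf' : ∀ j, ∀ n ∈ 𝓖 j, ∃ m ∈ 𝓜 j, f m = n) {e : ℤ}
    (hker : ∀ j, e < j → ∀ m ∈ 𝓜 j, f m = 0 → m = 0) (hN : RegLE x 𝓖 e) : RegLE x 𝓜 e := by
  intro i j hij z hz hz0
  obtain ⟨v', hv', hzv⟩ := hN i j hij (fun T => cechMap x f T (z T)) (fun T => (hz T).map x hf)
    (fun T hT => by rw [← cechMap_famD, hz0 T hT, map_zero])
  choose v hv hvv using fun T => (hv' T).exists_lift x hf'
  refine ⟨v, hv, fun T hT => ?_⟩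
  rw [← sub_eq_zero]
  -- The error of the lifted cochain `v` lies in the localized kernel of `f`; it remains to see that
  -- this vanishes in the given degree.
  have h0 : cechMap x f T (z T - famD x v T) = 0 := by
    rw [map_sub, hzv T hT, cechMap_famD, sub_eq_zero]
    simp only [hvv]
  obtain ⟨t, m, hm, e1, e2⟩ := ((hz T).sub x h𝓜
    (IsHomogeneousLoc.famD x h𝓜 hv T)).exists_of_cechMap_eq_zero x h𝓜 f h0
  apply cechProd_smul_injective x subset_rfl t
  simp only [e1, smul_zero]
  rw [cechOf_eq_zero_iff]
  -- For `i = 0` the numerator itself has degree `j > e`. For `i > 0`, multiplying by a power of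
  -- `x_T` pushes its degree beyond `e`, where the kernel is zero.
  rcases Nat.eq_zero_or_pos i with rfl | hi
  · rw [hT] at hm
    refine ⟨0, ?_⟩
    rw [hker _ (by simpa using hij) m (by simpa using hm) e2, smul_zero]
  · have hc : 1 ≤ T.card := hT ▸ hi
    refine ⟨(e + 1 - j).toNat, hker _ ?_ _ (h𝓜.cechProd_pow_smul_mem x T _ hm)
      (by rw [map_smul, e2, smul_zero])⟩
    have h1 : ((e + 1 - j).toNat : ℤ) ≤ (e + 1 - j).toNat * (T.card : ℤ) :=
      le_mul_of_one_le_right (by positivity) (by exact_mod_cast hc)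
    have h2 : 0 ≤ (t : ℤ) * T.card := by positivity
    have h3 := Int.self_le_toNat (e + 1 - j)
    linarith

theorem smul_injective_loc {l : Fin s} (hreg : ∀ m : M, x l • m = 0 → m = 0)
    (T : Finset (Fin s)) : Function.Injective fun z : CechLoc x M T => x l • z := by
  have key : ∀ z : CechLoc x M T, x l • z = 0 → z = 0 := by
    intro z hz
    obtain ⟨t, m, h⟩ := exists_cechOf_eq x T z
    have h1 : cechOf x M T (x l • m) = 0 := by rw [map_smul, ← h, smul_comm, hz, smul_zero]
    obtain ⟨c, hc⟩ := (cechOf_eq_zero_iff x T _).mp h1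
    rw [smul_comm] at hc
    apply cechProd_smul_injective x subset_rfl t
    simp only [h, smul_zero]
    exact (cechOf_eq_zero_iff x T _).mpr ⟨c, hreg _ hc⟩
  intro z w h
  rw [← sub_eq_zero]
  apply key
  rw [smul_sub, sub_eq_zero]
  exact h

theorem cechRes_insert_injective {l : Fin s} (hreg : ∀ m : M, x l • m = 0 → m = 0)
    {T : Finset (Fin s)} (hl : l ∉ T) :
    Function.Injective (cechRes x M (Finset.subset_insert l T)) := by
  rw [injective_iff_map_eq_zero]
  intro z hz
  obtain ⟨t, m, h⟩ := exists_cechOf_eq x T z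
  have h1 : cechOf x M (insert l T) m = 0 := by
    rw [← cechRes_cechOf x (Finset.subset_insert l T), ← h, map_smul, hz, smul_zero]
  obtain ⟨c, hc⟩ := (cechOf_eq_zero_iff x _ _).mp h1
  apply cechProd_smul_injective x subset_rfl t
  simp only [h, smul_zero]
  refine (cechOf_eq_zero_iff x T _).mpr ⟨c, ?_⟩
  rw [cechProd, Finset.prod_insert hl, mul_pow, mul_smul] at hc
  have hpow : ∀ (c : ℕ) (m : M), x l ^ c • m = 0 → m = 0 := by
    intro c
    induction c with
    | zero => intro m hm; simpa using hm
    | succ c ih =>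
      intro m hm
      rw [pow_succ, mul_smul] at hm
      exact hreg _ (ih _ hm)
  exact hpow _ _ hc

/-- A power of a nonzerodivisor `x l` kills the positive cohomology of the Čech complex. -/
theorem exists_pow_smul_eq_famD (h𝓜 : IsGradedBy x 𝓜) {l : Fin s}
    (hreg : ∀ m : M, x l • m = 0 → m = 0) {i : ℕ} {j : ℤ} {z : ∀ T, CechLoc x M T}
    (hz : ∀ T, IsHomogeneousLoc x 𝓜 T j (z T))
    (hz0 : ∀ T : Finset (Fin s), T.card = i + 1 → famD x z T = 0) :
    ∃ (t : ℕ) (w : ∀ T, CechLoc x M T), (∀ T, IsHomogeneousLoc x 𝓜 T (j + t) (w T)) ∧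
      ∀ T : Finset (Fin s), T.card = i → x l ^ t • z T = famD x w T := by
  obtain ⟨t, ht⟩ := exists_uniform_exponent x h𝓜 hz
  -- With `t` a common denominator exponent, `x_l ^ t` clears `x_l` from the denominator of `z
  -- (insert l T)`, so the product already lives in `M_{x_T}`.
  have hlift : ∀ T : Finset (Fin s), l ∉ T → ∃ u : CechLoc x M T,
      IsHomogeneousLoc x 𝓜 T (j + t) u ∧ cechRes x M (Finset.subset_insert l T) u =
        x l ^ t • z (insert l T) := by
    intro T hl
    obtain ⟨m, hm, e⟩ := ht (insert l T)
    refine ⟨cechFrac x T t m, ⟨t, m, ?_, smul_cechFrac x T t m⟩, ?_⟩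
    · rw [Finset.card_insert_of_notMem hl] at hm
      convert hm using 2
      push_cast; ring
    · apply cechProd_smul_injective x (Finset.subset_insert l T) t
      simp only [← map_smul, smul_cechFrac, cechRes_cechOf]
      rw [← e, cechProd, Finset.prod_insert hl, mul_pow, mul_comm, mul_smul]
      rfl
  choose u hu hres using hlift
  -- The contracting homotopy "insert `l`", available only after multiplication by `x_l ^ t`.
  let w : ∀ T, CechLoc x M T := fun T =>
    if hl : l ∉ T then cechSign R l T • u T hl else 0
  have hw0 : ∀ T, l ∈ T → w T = 0 := fun T h => dif_neg (by simpa using h)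
  have hw1 : ∀ T, l ∉ T → cechRes x M (Finset.subset_insert l T) (w T) =
      (cechSign R l T * x l ^ t) • z (insert l T) := fun T h => by
    simp only [w, dif_pos h, map_smul, hres, mul_smul]
  refine ⟨t, w, fun T => ?_, fun T hT => ?_⟩
  · by_cases hl : l ∈ T
    · rw [hw0 T hl]; exact .zero x _ _
    · simp only [w, dif_pos hl]; exact (hu T hl).sign_smul x _ _
  by_cases hl : l ∈ T
  · rw [famD, Finset.sum_eq_single_of_mem l hl fun l' hl' hne => by
      rw [hw0 _ (Finset.mem_erase.mpr ⟨hne.symm, hl⟩), map_zero, smul_zero]]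
    have h1 := hw1 (T.erase l) (Finset.notMem_erase l T)
    have h2 : ∀ T', T' = insert l (T.erase l) → ∀ h : T.erase l ⊆ T',
        cechRes x M h (w (T.erase l)) =
        (cechSign R l (T.erase l) * x l ^ t) • z T' := by
      rintro _ rfl _; exact h1
    rw [h2 T (Finset.insert_erase hl).symm, smul_smul, cechSign_erase_self, ← mul_assoc,
      cechSign_mul_self, one_mul]
  -- For `l ∉ T`, the identity is read off from the cocycle condition at `insert l T`, into whose
  -- localization `M_{x_T}` embeds.
  · apply cechRes_insert_injective x hreg hl
    have hc : (insert l T).card = i + 1 := by rw [Finset.card_insert_of_notMem hl, hT]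
    have hd := hz0 _ hc
    rw [famD, Finset.sum_insert hl] at hd
    have e1 := cechRes_congr x z (Finset.erase_insert hl)
      (Finset.erase_subset l (insert l T)) (Finset.subset_insert l T)
    rw [e1] at hd
    have hd' := congrArg (fun y => (cechSign R l (insert l T) * x l ^ t) • y) hd
    simp only [smul_add, smul_zero, smul_smul, Finset.smul_sum] at hd'
    rw [mul_right_comm, cechSign_mul_self, one_mul, add_eq_zero_iff_eq_neg] at hd'
    rw [map_smul, hd', famD, map_sum, ← Finset.sum_neg_distrib]
    refine Finset.sum_congr rfl fun l' hl' => ?_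
    have hne : l ≠ l' := fun h => hl (h ▸ hl')
    have hmem : l' ∈ insert l T := Finset.mem_insert_of_mem hl'
    have hnot : l ∉ T.erase l' := fun h => hl (Finset.mem_of_mem_erase h)
    have hins : insert l (T.erase l') = (insert l T).erase l' := by
      rw [Finset.erase_insert_of_ne hne]
    have hsub : insert l (T.erase l') ⊆ insert l T :=
      Finset.insert_subset_insert _ (Finset.erase_subset _ _)
    rw [map_smul, cechRes_trans,
      ← cechRes_trans x (Finset.subset_insert l (T.erase l')) hsub, hw1 _ hnot, map_smul,
      smul_smul, cechRes_congr x z hins hsub (Finset.erase_subset l' _), ← neg_smul]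
    congr 1
    have s1 := cechSign_swap (R := R) (Finset.mem_insert_self l T) hmem hne
    rw [Finset.erase_insert hl] at s1
    have s2 : cechSign R l (T.erase l') = cechSign R l ((insert l T).erase l') := by
      rw [← hins, ← cechSign_erase_self l (insert l (T.erase l')), Finset.erase_insert hnot]
    rw [s2]
    have s3 := cechSign_mul_self (R := R) l (insert l T)
    have s4 := cechSign_mul_self (R := R) l ((insert l T).erase l')
    set A := cechSign R l (insert l T)
    set B := cechSign R l' T
    set C := cechSign R l' (insert l T)
    set D := cechSign R l ((insert l T).erase l')
    linear_combination (-x l ^ t) * (A * D * s1 - B * D * s3 - A * C * s4)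

/-- If `x l` is a nonzerodivisor on `M`, regularity bounds pass from `N = M / x l M` to `M`. -/
theorem RegLE.of_smul_regular (h𝓜 : IsGradedBy x 𝓜) (f : M →ₗ[R] N)
    (hf : ∀ j, ∀ m ∈ 𝓜 j, f m ∈ 𝓖 j)
    (hf' : ∀ j, ∀ n ∈ 𝓖 j, ∃ m ∈ 𝓜 j, f m = n) {l : Fin s}
    (hreg : ∀ m : M, x l • m = 0 → m = 0) (hl : ∀ m : M, f (x l • m) = 0)
    (hker : ∀ j, ∀ m ∈ 𝓜 j, f m = 0 → ∃ m' ∈ 𝓜 (j - 1), m = x l • m')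
    {e : ℤ} (hN : RegLE x 𝓖 e) : RegLE x 𝓜 e := by
  -- Injectivity of `x_l` on `H^i` in degree `j`. If `x_l z = d w`, then `w` is a cocycle modulo
  -- `x_l`, of cohomological degree `i - 1` and internal degree `j + 1`, so still within reach of
  -- `hN`. Hence `w = d v + x_l u`, and cancelling `x_l` gives `z = d u`.
  have step : ∀ (i : ℕ) (j : ℤ), e < i + j → ∀ z : ∀ T, CechLoc x M T,
      (∃ w : ∀ T, CechLoc x M T, (∀ T, IsHomogeneousLoc x 𝓜 T (j + 1) (w T)) ∧
        ∀ T : Finset (Fin s), T.card = i → x l • z T = famD x w T) →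
      ∃ w : ∀ T, CechLoc x M T, (∀ T, IsHomogeneousLoc x 𝓜 T j (w T)) ∧
        ∀ T : Finset (Fin s), T.card = i → z T = famD x w T := by
    rintro i j hij z ⟨w, hw, hzw⟩
    rcases i with _ | i
    · refine ⟨fun _ => 0, fun T => .zero x T j, fun T hT => ?_⟩
      apply smul_injective_loc x hreg T
      obtain rfl := Finset.card_eq_zero.mp hT
      simpa [famD] using hzw ∅ rfl
    have hfx : ∀ T (y : CechLoc x M T), cechMap x f T (x l • y) = 0 := by
      intro T y
      obtain ⟨t, m, h⟩ := exists_cechOf_eq x T y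
      apply cechProd_smul_injective x subset_rfl t
      simp only [smul_zero]
      rw [← map_smul, smul_comm, h, ← map_smul, cechMap_cechOf, hl, map_zero]
    obtain ⟨v', hv', hwv⟩ := hN i (j + 1) (by push_cast at hij; linarith)
      (fun T => cechMap x f T (w T))
      (fun T => (hw T).map x hf) (fun T hT => by rw [← cechMap_famD, ← hzw T hT, hfx])
    choose v hv hvv using fun T => (hv' T).exists_lift x hf'
    have hu : ∀ T : Finset (Fin s), ∃ u : CechLoc x M T, IsHomogeneousLoc x 𝓜 T j u ∧
        (T.card = i → w T - famD x v T = x l • u) := by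
      intro T
      by_cases hT : T.card = i
      swap
      · exact ⟨0, .zero x T j, fun h => absurd h hT⟩
      have h0 : cechMap x f T (w T - famD x v T) = 0 := by
        rw [map_sub, hwv T hT, cechMap_famD, sub_eq_zero]
        simp only [hvv]
      obtain ⟨t, m, hm, e1, e2⟩ := ((hw T).sub x h𝓜
        (IsHomogeneousLoc.famD x h𝓜 hv T)).exists_of_cechMap_eq_zero x h𝓜 f h0
      obtain ⟨m', hm', rfl⟩ := hker _ _ hm e2
      refine ⟨cechFrac x T t m', ⟨t, m', ?_, smul_cechFrac x T t m'⟩, fun _ => ?_⟩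
      · convert hm' using 2
        ring
      · apply cechProd_smul_injective x subset_rfl t
        simp only [e1]
        rw [smul_comm, smul_cechFrac, map_smul]
    choose u hu hwu using hu
    refine ⟨u, hu, fun T hT => ?_⟩
    apply smul_injective_loc x hreg T
    simp only [hzw T hT]
    rw [← famD_smul, ← sub_zero (famD x w T), ← famD_famD x v T, ← famD_sub]
    refine famD_congr x fun l' hl' => hwu _ ?_
    rw [Finset.card_erase_of_mem hl', hT]; rfl
  have steps : ∀ (t i : ℕ) (j : ℤ), e < i + j → ∀ z : ∀ T, CechLoc x M T,
      (∃ w : ∀ T, CechLoc x M T, (∀ T, IsHomogeneousLoc x 𝓜 T (j + t) (w T)) ∧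
        ∀ T : Finset (Fin s), T.card = i → x l ^ t • z T = famD x w T) →
      ∃ w : ∀ T, CechLoc x M T, (∀ T, IsHomogeneousLoc x 𝓜 T j (w T)) ∧
        ∀ T : Finset (Fin s), T.card = i → z T = famD x w T := by
    intro t
    induction t with
    | zero => intro i j _ z h; simpa using h
    | succ t ih =>
      rintro i j hij z ⟨w, hw, hzw⟩
      refine ih i j hij z (step i (j + t) (by linarith [Int.natCast_nonneg t]) _ ⟨w, ?_, ?_⟩)
      · simpa [add_assoc] using hw
      · intro T hT
        rw [← hzw T hT, smul_smul, pow_succ']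
  -- Some power of `x_l` makes `z` a coboundary, and `steps` removes the factors one by one.
  intro i j hij z hz hz0
  obtain ⟨t, hw⟩ := exists_pow_smul_eq_famD x h𝓜 hreg hz hz0
  exact steps t i j hij z hw

/-- A homogeneous class in the range excluded by a regularity bound vanishes. -/
theorem RegLE.add_le {e : ℤ} (h : RegLE x 𝓜 e) {i : ℕ} {j : ℤ}
    {c : LocalCohomology x M i} (hc : c ∈ localCohomologyPiece x 𝓜 i j) (hne : c ≠ 0) :
    j + i ≤ e := by
  by_contra! hlt
  apply hne
  obtain ⟨z, hz, rfl⟩ := hc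
  have hz0 : ∀ T : Finset (Fin s), T.card = i + 1 → famD x (cochainFam x z.1) T = 0 := by
    intro T hT
    have := congrFun (LinearMap.mem_ker.mp z.2) ⟨T, hT⟩
    rwa [cechD_apply] at this
  have hhom : ∀ T, IsHomogeneousLoc x 𝓜 T j (cochainFam x z.1 T) := by
    intro T
    by_cases hT : T.card = i
    · rw [cochainFam_of_card x z.1 ⟨T, hT⟩]; exact hz ⟨T, hT⟩
    · rw [cochainFam, dif_neg hT]; exact .zero x T j
  obtain ⟨w, -, hw⟩ := h i j (by linarith) _ hhom hz0
  refine (Submodule.Quotient.mk_eq_zero _).mpr ?_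
  rw [Submodule.mem_comap, Submodule.subtype_apply]
  rcases i with _ | i
  · have : z.1 = 0 := by
      funext T
      have hT : T.1 = ∅ := Finset.card_eq_zero.mp T.2
      rw [← cochainFam_of_card x z.1 T, hw T.1 T.2, famD]
      simp [hT]
    rw [this]; exact zero_mem _
  · refine ⟨fun T => w T.1, ?_⟩
    funext T
    rw [cechD_apply, ← cochainFam_of_card x z.1 T, hw T.1 T.2]
    refine famD_congr x fun l hl => ?_
    have hc : (T.1.erase l).card = i := by rw [Finset.card_erase_of_mem hl, T.2]; rfl
    exact cochainFam_of_card x _ ⟨_, hc⟩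

end Homogeneous

/-! ### Nonzero classes in local cohomology -/

section LowerBounds

variable {R : Type u} [CommRing R] {s : ℕ} (x : Fin s → R)
variable {M : Type v} [AddCommGroup M] [Module R M] {𝓜 : ℤ → AddSubgroup M}

/-- A nonzero homogeneous socle element is a nonzero class in `H^0`. -/
theorem exists_ne_zero_of_socle {j : ℤ} {m : M} (hm : m ∈ 𝓜 j) (hne : m ≠ 0)
    (hx : ∀ l, x l • m = 0) : ∃ h ∈ localCohomologyPiece x 𝓜 0 j, h ≠ 0 := by
  let z : CechCochain x M 0 := fun T => cechOf x M T.1 m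
  have hz : z ∈ cechZ x M 0 := by
    refine LinearMap.mem_ker.mpr (funext fun T => ?_)
    rw [cechD_apply, famD]
    refine Finset.sum_eq_zero fun l hl => ?_
    have hc : (T.1.erase l).card = 0 := by rw [Finset.card_erase_of_mem hl, T.2]
    rw [cochainFam_of_card x z ⟨_, hc⟩, cechRes_cechOf, (cechOf_eq_zero_iff x T.1 m).mpr,
      smul_zero]
    refine ⟨1, ?_⟩
    rw [pow_one, cechProd, ← Finset.prod_erase_mul _ _ hl, mul_smul, hx, smul_zero]
  refine ⟨cechClass x M 0 ⟨z, hz⟩, ⟨_, fun T => ⟨0, m, by simpa using hm, by simp [z]⟩, rfl⟩, ?_⟩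
  intro h
  have h0 : z ∈ cechB x M 0 := (Submodule.Quotient.mk_eq_zero
    ((cechB x M 0).comap (cechZ x M 0).subtype)).mp h
  have h1 : z = 0 := h0
  have h2 : cechOf x M ∅ m = 0 := congrFun h1 ⟨∅, rfl⟩
  obtain ⟨t, ht⟩ := (cechOf_eq_zero_iff x ∅ m).mp h2
  exact hne (by simpa [cechProd] using ht)

/-- If the `x l`, `l ∉ T₀`, are nilpotent on `M` and `x_{T₀} ^ t m` never lies in the submodule
`∑ x_l ^ (t + 1) M`, `l ∈ T₀`, then the fraction `m / x_{T₀}` is a nonzero cohomology class. -/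
theorem exists_ne_zero_of_top {T₀ : Finset (Fin s)} {i : ℕ} (hT₀ : T₀.card = i + 1) {j : ℤ} {m : M}
    (hm : m ∈ 𝓜 j) (hnil : ∀ l, l ∉ T₀ → ∃ t : ℕ, ∀ m : M, x l ^ t • m = 0)
    (hnot : ∀ (t : ℕ) (u : Fin s → M),
      cechProd x T₀ ^ t • m ≠ ∑ l ∈ T₀, x l ^ (t + 1) • u l) :
    ∃ h ∈ localCohomologyPiece x 𝓜 (i + 1) (j - (i + 1)), h ≠ 0 := by
  let zf : ∀ T, CechLoc x M T := fun T => if T = T₀ then cechFrac x T 1 m else 0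
  let z : CechCochain x M (i + 1) := fun T => zf T.1
  have hz : z ∈ cechZ x M (i + 1) := by
    refine LinearMap.mem_ker.mpr (funext fun T => ?_)
    -- A set larger than `T₀` contains some `l ∉ T₀`; since `x l` is nilpotent on `M`, the
    -- localization there is zero and the cocycle condition is empty.
    obtain ⟨l, hl, hl'⟩ : ∃ l ∈ T.1, l ∉ T₀ :=
      Finset.exists_mem_notMem_of_card_lt_card (by rw [T.2, hT₀]; exact Nat.lt_succ_self _)
    obtain ⟨t, ht⟩ := hnil l hl'
    obtain ⟨c, m', h⟩ := exists_cechOf_eq x T.1 (cechD x M (i + 1) z T)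
    apply cechProd_smul_injective x subset_rfl c
    simp only [h, Pi.zero_apply, smul_zero]
    refine (cechOf_eq_zero_iff x T.1 m').mpr ⟨t, ?_⟩
    rw [cechProd, ← Finset.prod_erase_mul _ _ hl, mul_pow, mul_smul, ht, smul_zero]
  have hhom : ∀ T : {T : Finset (Fin s) // T.card = i + 1},
      IsHomogeneousLoc x 𝓜 T.1 (j - (i + 1)) (z T) := by
    intro T
    by_cases hT : T.1 = T₀
    · refine ⟨1, m, ?_, ?_⟩
      · rw [T.2]; push_cast; simpa using hm
      · simp only [z, zf, if_pos hT]; exact smul_cechFrac x T.1 1 m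
    · simp only [z, zf, if_neg hT]; exact .zero x _ _
  refine ⟨cechClass x M (i + 1) ⟨z, hz⟩, ⟨⟨z, hz⟩, hhom, rfl⟩, ?_⟩
  intro h
  have h0 : z ∈ cechB x M (i + 1) := (Submodule.Quotient.mk_eq_zero
    ((cechB x M (i + 1)).comap (cechZ x M (i + 1)).subtype)).mp h
  obtain ⟨w, hw⟩ := h0
  have hw0 : famD x (cochainFam x w) T₀ = cechFrac x T₀ 1 m := by
    rw [← cechD_apply x w ⟨T₀, hT₀⟩, hw]
    simp only [z, zf, if_true]
  -- The bounding cochain need not be homogeneous; the trivial grading serves only to get a common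
  -- denominator.
  obtain ⟨t, ht⟩ := exists_uniform_exponent x (𝓜 := fun _ => (⊤ : AddSubgroup M))
    (fun _ _ _ _ => trivial) (j := 0) (z := cochainFam x w) (fun T => by
      obtain ⟨t, m, h⟩ := exists_cechOf_eq x T (cochainFam x w T)
      exact ⟨t, m, trivial, h⟩)
  choose u _ hu using ht
  have h1 := congrArg (fun y => cechProd x T₀ ^ (t + 1) • y) hw0
  beta_reduce at h1
  rw [pow_succ, mul_smul _ _ (cechFrac x T₀ 1 m)] at h1
  have h2 := smul_cechFrac x T₀ 1 m
  rw [pow_one] at h2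
  rw [h2, famD, Finset.smul_sum, ← map_smul] at h1
  have h3 : ∀ l ∈ T₀, (cechProd x T₀ ^ t * cechProd x T₀) •
      (cechSign R l T₀ • cechRes x M (Finset.erase_subset l T₀) (cochainFam x w (T₀.erase l))) =
      cechOf x M T₀ ((cechSign R l T₀ * x l ^ t * cechProd x T₀) • u (T₀.erase l)) := by
    intro l hl
    have hp : cechProd x T₀ = cechProd x (T₀.erase l) * x l :=
      (Finset.prod_erase_mul _ _ hl).symm
    rw [map_smul, ← cechRes_cechOf x (Finset.erase_subset l T₀), ← hu, map_smul, smul_smul,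
      smul_smul]
    congr 1
    rw [hp]; ring
  rw [Finset.sum_congr rfl h3, ← map_sum, ← sub_eq_zero, ← map_sub, cechOf_eq_zero_iff] at h1
  obtain ⟨c, hc⟩ := h1
  rw [smul_sub, sub_eq_zero, smul_smul, ← pow_add, Finset.smul_sum] at hc
  refine hnot (c + t) (fun l => (cechSign R l T₀ * cechProd x (T₀.erase l) ^ (c + 1)) •
    u (T₀.erase l)) ?_
  rw [← hc]
  refine Finset.sum_congr rfl fun l hl => ?_
  have hp : cechProd x T₀ = cechProd x (T₀.erase l) * x l :=
    (Finset.prod_erase_mul _ _ hl).symm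
  rw [smul_smul, smul_smul]
  congr 1
  rw [hp]; ring

end LowerBounds

/-! ### Regularity of quotients by ideals -/

section Quotients

variable {k : Type u} [Field k] {R : Type v} [CommRing R] [Algebra k R]
variable {𝒜 : ℕ → Submodule k R} {s : ℕ} {x : Fin s → R}

theorem mem_quotientGrading_natCast {K : Ideal R} {n : ℕ} {m : R ⧸ K} :
    m ∈ quotientGrading 𝒜 K n ↔ ∃ a ∈ 𝒜 n, Ideal.Quotient.mk K a = m :=
  Iff.rfl

theorem eq_natCast_or_eq_zero_of_mem_quotientGrading {K : Ideal R} {j : ℤ} {m : R ⧸ K}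
    (hm : m ∈ quotientGrading 𝒜 K j) :
    (∃ n : ℕ, j = n ∧ ∃ a ∈ 𝒜 n, Ideal.Quotient.mk K a = m) ∨ m = 0 := by
  rcases j with n | n
  · exact Or.inl ⟨n, rfl, hm⟩
  · exact Or.inr hm

theorem isGradedBy_quotientGrading [SetLike.GradedMonoid 𝒜] (hx : ∀ l, x l ∈ 𝒜 1) (K : Ideal R) :
    IsGradedBy x (quotientGrading 𝒜 K) := by
  intro l j m hm
  rcases eq_natCast_or_eq_zero_of_mem_quotientGrading hm with ⟨n, rfl, a, ha, rfl⟩ | rfl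
  · refine mem_quotientGrading_natCast (n := n + 1).mpr ⟨x l * a, ?_, rfl⟩
    rw [add_comm]
    exact SetLike.mul_mem_graded (hx l) ha
  · rw [smul_zero]; exact zero_mem _

theorem factor_mem_quotientGrading {K K' : Ideal R} (h : K ≤ K') (j : ℤ) (m : R ⧸ K)
    (hm : m ∈ quotientGrading 𝒜 K j) :
    (Ideal.Quotient.factorₐ R h).toLinearMap m ∈ quotientGrading 𝒜 K' j := by
  rcases eq_natCast_or_eq_zero_of_mem_quotientGrading hm with ⟨n, rfl, a, ha, rfl⟩ | rfl
  · exact ⟨a, ha, rfl⟩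
  · rw [map_zero]; exact zero_mem _

theorem exists_factor_eq {K K' : Ideal R} (h : K ≤ K') (j : ℤ) (m : R ⧸ K')
    (hm : m ∈ quotientGrading 𝒜 K' j) :
    ∃ m' ∈ quotientGrading 𝒜 K j, (Ideal.Quotient.factorₐ R h).toLinearMap m' = m := by
  rcases eq_natCast_or_eq_zero_of_mem_quotientGrading hm with ⟨n, rfl, a, ha, rfl⟩ | rfl
  · exact ⟨Ideal.Quotient.mk K a, ⟨a, ha, rfl⟩, rfl⟩
  · exact ⟨0, zero_mem _, map_zero _⟩

/-- `RegLE.of_map` for `R ⧸ K → R ⧸ K'`: by `hK` the kernel `K' / K` has nothing in degrees above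
`e`. -/
theorem RegLE.quotient_of_le [SetLike.GradedMonoid 𝒜] (hx : ∀ l, x l ∈ 𝒜 1) {K K' : Ideal R}
    (h : K ≤ K') {e : ℕ} (hK : ∀ n, e < n → ∀ a ∈ 𝒜 n, a ∈ K' → a ∈ K)
    (hN : RegLE x (quotientGrading 𝒜 K') e) : RegLE x (quotientGrading 𝒜 K) e := by
  refine RegLE.of_map x (isGradedBy_quotientGrading hx K) _ (factor_mem_quotientGrading h)
    (exists_factor_eq h) (fun j hj m hm hm0 => ?_) hN
  rcases eq_natCast_or_eq_zero_of_mem_quotientGrading hm with ⟨n, rfl, a, ha, rfl⟩ | rfl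
  · exact Ideal.Quotient.eq_zero_iff_mem.mpr
      (hK n (by exact_mod_cast hj) a ha (Ideal.Quotient.eq_zero_iff_mem.mp hm0))
  · rfl

/-- `RegLE.of_smul_regular` with `K'` in the role of `K + (x l)`. The alternative `a ∈ K` in `hK`
covers degree zero, where no quotient by `x l` exists. -/
theorem RegLE.quotient_of_regular [SetLike.GradedMonoid 𝒜] (hx : ∀ l, x l ∈ 𝒜 1) {K K' : Ideal R}
    (h : K ≤ K') {l : Fin s} (hl : x l ∈ K') (hreg : ∀ a, x l * a ∈ K → a ∈ K)
    (hK : ∀ n, ∀ a ∈ 𝒜 n, a ∈ K' → a ∈ K ∨ ∃ n' b, n = n' + 1 ∧ b ∈ 𝒜 n' ∧ a - x l * b ∈ K)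
    {e : ℤ} (hN : RegLE x (quotientGrading 𝒜 K') e) : RegLE x (quotientGrading 𝒜 K) e := by
  refine RegLE.of_smul_regular x (isGradedBy_quotientGrading hx K) _
    (factor_mem_quotientGrading h) (exists_factor_eq h) (l := l) (fun m hm => ?_) (fun m => ?_)
    (fun j m hm hm0 => ?_) hN
  · obtain ⟨a, rfl⟩ := Ideal.Quotient.mk_surjective m
    exact Ideal.Quotient.eq_zero_iff_mem.mpr (hreg a (Ideal.Quotient.eq_zero_iff_mem.mp hm))
  · obtain ⟨a, rfl⟩ := Ideal.Quotient.mk_surjective m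
    exact Ideal.Quotient.eq_zero_iff_mem.mpr (K'.mul_mem_right a hl)
  · rcases eq_natCast_or_eq_zero_of_mem_quotientGrading hm with ⟨n, rfl, a, ha, rfl⟩ | rfl
    · rcases hK n a ha (Ideal.Quotient.eq_zero_iff_mem.mp hm0) with h0 | ⟨n', b, rfl, hb, hab⟩
      · exact ⟨0, zero_mem _, by rw [smul_zero]; exact Ideal.Quotient.eq_zero_iff_mem.mpr h0⟩
      · refine ⟨Ideal.Quotient.mk K b, ?_, Ideal.Quotient.eq.mpr hab⟩
        rw [show ((n' + 1 : ℕ) : ℤ) - 1 = n' by push_cast; ring]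
        exact ⟨b, hb, rfl⟩
    · exact ⟨0, zero_mem _, (smul_zero _).symm⟩

/-- The regularity is determined by an upper bound and a nonzero class attaining it. -/
theorem IsRegularity.of_regLE {M : Type v} [AddCommGroup M] [Module R M] {𝓜 : ℤ → AddSubgroup M}
    {e : ℤ} (h : RegLE x 𝓜 e) {i : ℕ} {j : ℤ} (hij : j + i = e)
    (hne : ∃ c ∈ localCohomologyPiece x 𝓜 i j, c ≠ 0) : IsRegularity x 𝓜 e := by
  refine ⟨⟨i, j, hne, hij.symm⟩, ?_⟩
  rintro _ ⟨i', j', ⟨c, hc, hc0⟩, rfl⟩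
  exact h.add_le x hc hc0

end Quotients

/-! ### Quotients of polynomial rings by monomial ideals -/

section MonomialQuotient

open MvPolynomial

variable {k : Type u} [Field k] {σ : Type} {R : Type u} [CommRing R] [Algebra k R]

/-- `π` presents `R` as the quotient of a polynomial ring by the ideal spanned by the monomials
with exponent in `U`. -/
structure IsMonPresentation (π : MvPolynomial σ k →ₐ[k] R) (U : Set (σ →₀ ℕ)) : Prop where
  surjective : Function.Surjective π
  eq_zero_iff : ∀ p, π p = 0 ↔ ∀ u, coeff u p ≠ 0 → u ∈ U

/-- The grading induced by the standard grading of the polynomial ring. -/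
def monGrading (π : MvPolynomial σ k →ₐ[k] R) (n : ℕ) : Submodule k R :=
  (homogeneousSubmodule σ k n).map π.toLinearMap

/-- The ideal spanned by the classes of the monomials with exponent in the upper set `V`. -/
def monIdeal (π : MvPolynomial σ k →ₐ[k] R) {V : Set (σ →₀ ℕ)} (hV : IsUpperSet V) : Ideal R :=
  (restrictSupportIdeal k V hV).map π

theorem mem_restrictSupportIdeal {V : Set (σ →₀ ℕ)} (hV : IsUpperSet V) {p : MvPolynomial σ k} :
    p ∈ restrictSupportIdeal k V hV ↔ ∀ u, coeff u p ≠ 0 → u ∈ V := by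
  change ((p.support : Set (σ →₀ ℕ)) ⊆ V) ↔ _
  simp [Set.subset_def]

theorem isMonPresentation_mkₐ {U : Set (σ →₀ ℕ)} (hU : IsUpperSet U) :
    IsMonPresentation (Ideal.Quotient.mkₐ k (restrictSupportIdeal k U hU)) U where
  surjective := Ideal.Quotient.mkₐ_surjective _ _
  eq_zero_iff _ := Ideal.Quotient.eq_zero_iff_mem.trans (mem_restrictSupportIdeal hU)

variable {π : MvPolynomial σ k →ₐ[k] R} {U : Set (σ →₀ ℕ)}

theorem map_mem_monGrading {n : ℕ} {p : MvPolynomial σ k} (hp : p.IsHomogeneous n) :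
    π p ∈ monGrading π n :=
  ⟨p, hp, rfl⟩

theorem exists_of_mem_monGrading {n : ℕ} {a : R} (ha : a ∈ monGrading π n) :
    ∃ p : MvPolynomial σ k, p.IsHomogeneous n ∧ π p = a := by
  obtain ⟨p, hp, rfl⟩ := ha
  exact ⟨p, hp, rfl⟩

theorem degree_eq_of_isHomogeneous {n : ℕ} {p : MvPolynomial σ k} (hp : p.IsHomogeneous n)
    {u : σ →₀ ℕ} (hu : coeff u p ≠ 0) : u.degree = n := by
  by_contra h
  exact hu (hp.coeff_eq_zero h)

theorem coeff_monomial_ne_zero {u v : σ →₀ ℕ} {a : k} (h : coeff v (monomial u a) ≠ 0) :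
    v = u := by
  classical
  rw [coeff_monomial] at h
  by_contra h'
  exact h (if_neg (Ne.symm h'))

/-- Since `U ⊆ V`, changing the representative alters only coefficients at exponents of `V`. This
reduces all ideal membership to combinatorics of exponents. -/
theorem IsMonPresentation.map_mem_monIdeal (hπ : IsMonPresentation π U) {V : Set (σ →₀ ℕ)}
    (hV : IsUpperSet V) (h : U ⊆ V) {p : MvPolynomial σ k} :
    π p ∈ monIdeal π hV ↔ ∀ u, coeff u p ≠ 0 → u ∈ V := by
  rw [monIdeal, Ideal.mem_map_iff_of_surjective π hπ.surjective]
  constructor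
  · rintro ⟨q, hq, hqp⟩ u hu
    by_cases hqu : coeff u q = 0
    · refine h ((hπ.eq_zero_iff (q - p)).mp (by rw [map_sub, hqp, sub_self]) u ?_)
      rwa [coeff_sub, hqu, zero_sub, neg_ne_zero]
    · exact (mem_restrictSupportIdeal hV).mp hq u hqu
  · intro hp
    exact ⟨p, (mem_restrictSupportIdeal hV).mpr hp, rfl⟩

theorem IsMonPresentation.map_monomial_mem_monIdeal (hπ : IsMonPresentation π U)
    {V : Set (σ →₀ ℕ)} (hV : IsUpperSet V) (h : U ⊆ V) {u : σ →₀ ℕ} :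
    π (monomial u 1) ∈ monIdeal π hV ↔ u ∈ V := by
  rw [hπ.map_mem_monIdeal hV h]
  constructor
  · intro H
    classical
    exact H u (by rw [coeff_monomial, if_pos rfl]; exact one_ne_zero)
  · rintro H v hv
    exact coeff_monomial_ne_zero hv ▸ H

theorem monIdeal_mono {V V' : Set (σ →₀ ℕ)} (hV : IsUpperSet V) (hV' : IsUpperSet V')
    (h : V ⊆ V') : monIdeal π hV ≤ monIdeal π hV' :=
  Ideal.map_mono fun _ hp =>
    (mem_restrictSupportIdeal hV').mpr fun u hu => h ((mem_restrictSupportIdeal hV).mp hp u hu)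

theorem monGrading_gradedMonoid (π : MvPolynomial σ k →ₐ[k] R) :
    SetLike.GradedMonoid (monGrading π) where
  one_mem := ⟨1, isHomogeneous_one σ k, map_one π⟩
  mul_mem := by
    rintro i j _ _ ⟨p, hp, rfl⟩ ⟨q, hq, rfl⟩
    exact ⟨p * q, IsHomogeneous.mul hp hq, map_mul π p q⟩

/-- The decomposition of a polynomial into the classes of its homogeneous components. -/
def monDecomposePoly (π : MvPolynomial σ k →ₐ[k] R) :
    MvPolynomial σ k →ₗ[k] DirectSum ℕ fun n => monGrading π n :=
  (basisMonomials σ k).constr k fun u =>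
    DirectSum.lof k ℕ (fun n => monGrading π n) u.degree
      ⟨π (monomial u 1), map_mem_monGrading (isHomogeneous_monomial _ rfl)⟩

theorem monDecomposePoly_monomial (u : σ →₀ ℕ) (a : k) :
    monDecomposePoly π (monomial u a) = DirectSum.lof k ℕ (fun n => monGrading π n) u.degree
      ⟨π (monomial u a), map_mem_monGrading (isHomogeneous_monomial _ rfl)⟩ := by
  have h : monomial u a = a • basisMonomials σ k u := by
    rw [coe_basisMonomials, smul_monomial, smul_eq_mul, mul_one]
  have h' : monDecomposePoly π (monomial u a) = a • DirectSum.lof k ℕ (fun n => monGrading π n)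
      u.degree ⟨π (monomial u 1), map_mem_monGrading (isHomogeneous_monomial _ rfl)⟩ := by
    rw [h, map_smul, monDecomposePoly, Module.Basis.constr_basis]
  rw [h', ← map_smul]
  congr 1
  apply Subtype.ext
  simp [← map_smul]

theorem monDecomposePoly_of_isHomogeneous {n : ℕ} {p : MvPolynomial σ k} (hp : p.IsHomogeneous n) :
    monDecomposePoly π p = DirectSum.lof k ℕ (fun n => monGrading π n) n
      ⟨π p, map_mem_monGrading hp⟩ := by
  have key : ∀ u ∈ p.support, monDecomposePoly π (monomial u (coeff u p)) =
      DirectSum.lof k ℕ (fun n => monGrading π n) n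
        (if h : u.degree = n then ⟨π (monomial u (coeff u p)),
          map_mem_monGrading (isHomogeneous_monomial _ h)⟩ else 0) := by
    intro u hu
    obtain rfl := degree_eq_of_isHomogeneous hp (mem_support_iff.mp hu)
    rw [monDecomposePoly_monomial, dif_pos rfl]
  have e : monDecomposePoly π p = ∑ u ∈ p.support, monDecomposePoly π (monomial u (coeff u p)) := by
    rw [← map_sum, ← p.as_sum]
  rw [e, Finset.sum_congr rfl key, ← map_sum]
  congr 1
  apply Subtype.ext
  rw [AddSubmonoidClass.coe_finsetSum]
  have e' : π p = ∑ u ∈ p.support, π (monomial u (coeff u p)) := by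
    rw [← map_sum, ← p.as_sum]
  refine Eq.trans (Finset.sum_congr rfl fun u hu => ?_) e'.symm
  rw [dif_pos (degree_eq_of_isHomogeneous hp (mem_support_iff.mp hu))]

/-- The kernel is spanned by monomials, which are homogeneous; hence the decomposition descends to
`R`. -/
theorem IsMonPresentation.ker_le (hπ : IsMonPresentation π U) :
    LinearMap.ker π.toLinearMap ≤ LinearMap.ker (monDecomposePoly π) := by
  intro p hp
  have hp' := (hπ.eq_zero_iff p).mp hp
  rw [LinearMap.mem_ker, p.as_sum, map_sum]
  refine Finset.sum_eq_zero fun u hu => ?_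
  rw [monDecomposePoly_monomial]
  have h0 : π (monomial u (coeff u p)) = 0 := by
    refine (hπ.eq_zero_iff _).mpr fun v hv => ?_
    rw [coeff_monomial_ne_zero hv]
    exact hp' u (mem_support_iff.mp hu)
  rw [show (⟨π (monomial u (coeff u p)), map_mem_monGrading (isHomogeneous_monomial _ rfl)⟩ :
    monGrading π u.degree) = 0 from Subtype.ext h0, map_zero]

theorem IsMonPresentation.exists_decompose (hπ : IsMonPresentation π U) :
    ∃ δ : R →ₗ[k] DirectSum ℕ fun n => monGrading π n,
      ∀ p, δ (π p) = monDecomposePoly π p := by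
  obtain ⟨g, hg⟩ := π.toLinearMap.exists_rightInverse_of_surjective
    (LinearMap.range_eq_top.mpr hπ.surjective)
  refine ⟨(monDecomposePoly π).comp g, fun p => ?_⟩
  have h : g (π p) - p ∈ LinearMap.ker π.toLinearMap := by
    rw [LinearMap.mem_ker, map_sub, sub_eq_zero]
    exact LinearMap.congr_fun hg (π p)
  have h' := hπ.ker_le h
  rw [LinearMap.mem_ker, map_sub, sub_eq_zero] at h'
  exact h'

/-- The induced grading is an algebra grading. -/
@[reducible] def IsMonPresentation.gradedAlgebra (hπ : IsMonPresentation π U) :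
    GradedAlgebra (monGrading π) where
  toGradedMonoid := monGrading_gradedMonoid π
  toDecomposition := DirectSum.Decomposition.ofLinearMap _ hπ.exists_decompose.choose
    (by
      refine LinearMap.ext fun a => ?_
      obtain ⟨p, rfl⟩ := hπ.surjective a
      rw [LinearMap.comp_apply, hπ.exists_decompose.choose_spec, LinearMap.id_apply, p.as_sum,
        map_sum, map_sum, map_sum]
      refine Finset.sum_congr rfl fun u _ => ?_
      rw [monDecomposePoly_monomial, DirectSum.coeLinearMap_lof])
    (by
      refine DirectSum.linearMap_ext _ fun n => LinearMap.ext ?_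
      rintro ⟨a, ha⟩
      obtain ⟨p, hp, rfl⟩ := exists_of_mem_monGrading ha
      rw [LinearMap.comp_apply, LinearMap.comp_apply, DirectSum.coeLinearMap_lof,
        hπ.exists_decompose.choose_spec, monDecomposePoly_of_isHomogeneous hp]
      rfl)

variable {s : ℕ} (e : Fin s ≃ σ)

variable (π) in
/-- The classes of the variables. -/
def monVar (l : Fin s) : R := π (X (e l))

theorem monVar_mem (l : Fin s) : monVar π e l ∈ monGrading π 1 :=
  map_mem_monGrading (isHomogeneous_X k _)

theorem IsMonPresentation.adjoin_range_monVar (hπ : IsMonPresentation π U) :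
    Algebra.adjoin k (Set.range (monVar π e)) = ⊤ := by
  have h : Set.range (monVar π e) = π '' Set.range (X : σ → MvPolynomial σ k) := by
    rw [← Set.range_comp, ← e.surjective.range_comp]
    rfl
  rw [h, ← AlgHom.map_adjoin, adjoin_range_X, Algebra.map_top, AlgHom.range_eq_top]
  exact hπ.surjective

theorem RegLE.monIdeal_of_subset (hπ : IsMonPresentation π U) {V V' : Set (σ →₀ ℕ)}
    (hV : IsUpperSet V) (hV' : IsUpperSet V')
    (hUV : U ⊆ V) (hVV' : V ⊆ V') {b : ℕ} (h : ∀ u ∈ V', b < u.degree → u ∈ V)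
    (hreg : RegLE (monVar π e) (quotientGrading (monGrading π) (monIdeal π hV')) b) :
    RegLE (monVar π e) (quotientGrading (monGrading π) (monIdeal π hV)) b := by
  have := monGrading_gradedMonoid π
  refine RegLE.quotient_of_le (monVar_mem e) (monIdeal_mono hV hV' hVV')
    (fun n hn a ha haV => ?_) hreg
  obtain ⟨p, hp, rfl⟩ := exists_of_mem_monGrading ha
  refine (hπ.map_mem_monIdeal hV hUV).mpr fun u hu => ?_
  exact h u ((hπ.map_mem_monIdeal hV' (hUV.trans hVV')).mp haV u hu)
    (degree_eq_of_isHomogeneous hp hu ▸ hn)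

/-- Here `h` says that the variable `i` is a nonzerodivisor modulo `V`, and `hVV'` that `V'` arises
from `V` by adding that variable. -/
theorem RegLE.monIdeal_of_regular (hπ : IsMonPresentation π U) {V V' : Set (σ →₀ ℕ)}
    (hV : IsUpperSet V) (hV' : IsUpperSet V')
    (hUV : U ⊆ V) (i : σ) (h : ∀ u, u + Finsupp.single i 1 ∈ V → u ∈ V)
    (hVV' : ∀ u, u ∈ V' ↔ u ∈ V ∨ u i ≠ 0) {b : ℤ}
    (hreg : RegLE (monVar π e) (quotientGrading (monGrading π) (monIdeal π hV')) b) :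
    RegLE (monVar π e) (quotientGrading (monGrading π) (monIdeal π hV)) b := by
  have := monGrading_gradedMonoid π
  have hsub : V ⊆ V' := fun u hu => (hVV' u).mpr (Or.inl hu)
  have hvar : monVar π e (e.symm i) = π (X i) := by rw [monVar, e.apply_symm_apply]
  refine RegLE.quotient_of_regular (monVar_mem e)
    (monIdeal_mono hV hV' hsub) (l := e.symm i) ?_ ?_ ?_ hreg
  · rw [hvar, X, hπ.map_monomial_mem_monIdeal hV' (hUV.trans hsub)]
    exact (hVV' _).mpr (Or.inr (by simp))
  · intro a ha
    obtain ⟨p, rfl⟩ := hπ.surjective a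
    rw [hvar, ← map_mul] at ha
    refine (hπ.map_mem_monIdeal hV hUV).mpr fun u hu => h u ?_
    refine (hπ.map_mem_monIdeal hV hUV).mp ha _ ?_
    rwa [add_comm, coeff_X_mul]
  · intro n a ha hpV
    obtain ⟨p, hp, rfl⟩ := exists_of_mem_monGrading ha
    have hpV' := (hπ.map_mem_monIdeal hV' (hUV.trans hsub)).mp hpV
    rcases n with _ | n
    · left
      refine (hπ.map_mem_monIdeal hV hUV).mpr fun u hu => ?_
      refine ((hVV' u).mp (hpV' u hu)).resolve_right fun h0 => h0 ?_
      rw [(Finsupp.degree_eq_zero_iff u).mp (degree_eq_of_isHomogeneous hp hu)]; rfl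
    · right
      -- Division by `X i`: the remainder involves only monomials free of `X i`, and those of `V'`
      -- already lie in `V`.
      refine ⟨n, π (p.divMonomial (Finsupp.single i 1)), rfl, map_mem_monGrading ?_, ?_⟩
      · intro u hu
        rw [coeff_divMonomial] at hu
        have := degree_eq_of_isHomogeneous hp hu
        rw [map_add, Finsupp.degree_single] at this
        have hw : Finsupp.weight (1 : σ → ℕ) u = u.degree := by
          rw [Finsupp.degree_eq_weight_one]; rfl
        omega
      · have hd := divMonomial_add_modMonomial_single p i
        rw [hvar, ← map_mul, ← map_sub,
          show p - X i * p.divMonomial (Finsupp.single i 1) = p.modMonomial (Finsupp.single i 1) by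
            rw [sub_eq_iff_eq_add', hd]]
        refine (hπ.map_mem_monIdeal hV hUV).mpr fun u hu => ?_
        by_cases hle : Finsupp.single i 1 ≤ u
        · exact absurd (coeff_modMonomial_of_le p hle) hu
        · rw [coeff_modMonomial_of_not_le p hle] at hu
          refine ((hVV' u).mp (hpV' u hu)).resolve_right fun h0 => hle ?_
          rw [Finsupp.single_le_iff]
          exact Nat.one_le_iff_ne_zero.mpr h0

end MonomialQuotient

/-- Dividing out nilpotents leaves the spectrum unchanged. -/
theorem ringKrullDim_eq_of_ker_le_nilradical {A : Type u} {B : Type v} [CommRing A] [CommRing B]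
    (f : A →+* B) (hf : Function.Surjective f) (hker : RingHom.ker f ≤ nilradical A) :
    ringKrullDim A = ringKrullDim B := by
  rw [← ringKrullDim_eq_of_ringEquiv (RingHom.quotientKerEquivOfSurjective hf),
    ringKrullDim_quotient,
    (PrimeSpectrum.zeroLocus_eq_univ_iff _).mpr hker]
  exact (Order.krullDim_eq_of_orderIso OrderIso.Set.univ).symm

/-! ### Rings made of chains: regularity, powers, dimension -/

section Chains

open MvPolynomial

variable {k : Type u} [Field k] {r : ℕ} {C : Type}

/-- The exponents `u` of the monomials `y ^ α * x ^ β` such that either two of the `x_c` occur, or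
`Q c i t` holds for some `c`, where `i` is the exponent of `x_c` and `t = |α|`. -/
def chainSet (r : ℕ) (Q : C → ℕ → ℕ → Prop) : Set (Fin r ⊕ C →₀ ℕ) :=
  {u | (∃ c c', c ≠ c' ∧ u (Sum.inr c) ≠ 0 ∧ u (Sum.inr c') ≠ 0) ∨
    ∃ c, Q c (u (Sum.inr c)) (∑ l, u (Sum.inl l))}

theorem isUpperSet_chainSet {Q : C → ℕ → ℕ → Prop}
    (hQ : ∀ c i i' t t', i ≤ i' → t ≤ t' → Q c i t → Q c i' t') :
    IsUpperSet (chainSet r Q) := by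
  rintro u v huv (⟨c, c', hne, h, h'⟩ | ⟨c, h⟩)
  · have h1 := huv (Sum.inr c)
    have h2 := huv (Sum.inr c')
    exact Or.inl ⟨c, c', hne, by omega, by omega⟩
  · exact Or.inr ⟨c, hQ _ _ _ _ _ (huv _) (Finset.sum_le_sum fun l _ => huv _) h⟩

theorem chainSet_mono {Q Q' : C → ℕ → ℕ → Prop} (h : ∀ c i t, Q c i t → Q' c i t) :
    chainSet r Q ⊆ chainSet r Q' := by
  rintro u (h' | ⟨c, hc⟩)
  · exact Or.inl h'
  · exact Or.inr ⟨c, h _ _ _ hc⟩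

theorem degree_eq_sum_add_sum [Fintype C] (u : Fin r ⊕ C →₀ ℕ) :
    u.degree = ∑ l, u (Sum.inl l) + ∑ c, u (Sum.inr c) := by
  rw [Finsupp.degree_eq_sum, Fintype.sum_sum_type]

theorem degree_eq_of_not_two [Fintype C] {u : Fin r ⊕ C →₀ ℕ}
    (h : ¬ ∃ c c', c ≠ c' ∧ u (Sum.inr c) ≠ 0 ∧ u (Sum.inr c') ≠ 0) {c : C}
    (hc : u (Sum.inr c) ≠ 0) : u.degree = ∑ l, u (Sum.inl l) + u (Sum.inr c) := by
  rw [degree_eq_sum_add_sum, Finset.sum_eq_single_of_mem c (Finset.mem_univ c)]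
  intro c' _ hne
  by_contra h'
  exact h ⟨c, c', hne.symm, hc, h'⟩

variable {R : Type u} [CommRing R] [Algebra k R] {π : MvPolynomial (Fin r ⊕ C) k →ₐ[k] R}
  {U : Set (Fin r ⊕ C →₀ ℕ)} {s : ℕ} (e : Fin s ≃ Fin r ⊕ C)

/-- If the module of the chain `c` is free over `k[y]` in the exponents `i < p c` and lives in
degrees at most `b` from there on, then the regularity is at most `b`. -/
theorem regLE_chainSet [Fintype C] (hπ : IsMonPresentation π U) {Q : C → ℕ → ℕ → Prop}
    (hV : IsUpperSet (chainSet r Q)) (hUV : U ⊆ chainSet r Q) {b : ℕ} (p : C → ℕ)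
    (hp0 : ∀ c, 0 < p c) (hpb : ∀ c, p c ≤ b + 1) (hQp : ∀ c i t, Q c i t → p c ≤ i)
    (hpQ : ∀ c i t, p c ≤ i → b < i + t → Q c i t) :
    RegLE (monVar π e) (quotientGrading (monGrading π) (monIdeal π hV)) b := by
  -- `W 0` cuts every chain at `p c`, leaving a free `k[y]`-module; `W q` also kills the first `q`
  -- of the `y_l`.
  let W : ℕ → Set (Fin r ⊕ C →₀ ℕ) := fun q =>
    {u | u ∈ chainSet r (fun c i _ => p c ≤ i) ∨ ∃ l : Fin r, l.1 < q ∧ u (Sum.inl l) ≠ 0}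
  have hP : IsUpperSet (chainSet r (C := C) (fun c i _ => p c ≤ i)) :=
    isUpperSet_chainSet fun c i i' t t' h _ h' => h'.trans h
  have hW : ∀ q, IsUpperSet (W q) := by
    rintro q u v huv (h | ⟨l, hl, h⟩)
    · exact Or.inl (hP huv h)
    · have := huv (Sum.inl l)
      exact Or.inr ⟨l, hl, by omega⟩
  have hVW : ∀ q, chainSet r Q ⊆ W q := fun q u hu => Or.inl (chainSet_mono hQp hu)
  have hreg : ∀ q, RegLE (monVar π e)
      (quotientGrading (monGrading π) (monIdeal π (hW (r - q)))) b := by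
    intro q
    induction q with
    | zero =>
      -- With all `y_l` killed, the surviving monomials are powers of a single `x_c` with exponent
      -- below `p c ≤ b + 1`, so everything sits in degrees at most `b` and comparison with the zero
      -- ring suffices.
      refine RegLE.monIdeal_of_subset e hπ (hW _) isUpperSet_univ (hUV.trans (hVW _))
        (Set.subset_univ _) (fun u _ hu => ?_) ?_
      · by_cases hy : ∃ l : Fin r, u (Sum.inl l) ≠ 0
        · obtain ⟨l, hl⟩ := hy
          exact Or.inr ⟨l, l.2, hl⟩
        by_cases h2 : ∃ c c', c ≠ c' ∧ u (Sum.inr c) ≠ 0 ∧ u (Sum.inr c') ≠ 0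
        · exact Or.inl (Or.inl h2)
        push Not at hy
        have hy0 : ∑ l, u (Sum.inl l) = 0 := Finset.sum_eq_zero fun l _ => hy l
        obtain ⟨c, hc⟩ : ∃ c, u (Sum.inr c) ≠ 0 := by
          by_contra! h
          rw [degree_eq_sum_add_sum, hy0, Finset.sum_eq_zero fun c _ => h c] at hu
          omega
        have := degree_eq_of_not_two h2 hc
        have := hpb c
        exact Or.inl (Or.inr ⟨c, by omega⟩)
      · have htop : monIdeal π (isUpperSet_univ (α := Fin r ⊕ C →₀ ℕ)) = ⊤ := by
          rw [Ideal.eq_top_iff_one, ← map_one π, hπ.map_mem_monIdeal _ (Set.subset_univ _)]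
          exact fun _ _ => trivial
        rw [htop]
        have : Subsingleton (R ⧸ (⊤ : Ideal R)) := Ideal.Quotient.subsingleton_iff.mpr rfl
        exact RegLE.of_subsingleton _ _
    | succ q ih =>
      rcases Nat.lt_or_ge q r with hq | hq
      swap
      · have hcongr : ∀ q' q'', q' = q'' →
            RegLE (monVar π e) (quotientGrading (monGrading π) (monIdeal π (hW q'))) b →
            RegLE (monVar π e) (quotientGrading (monGrading π) (monIdeal π (hW q''))) b := by
          rintro q' _ rfl h; exact h
        exact hcongr _ _ (by omega) ih
      have hq' : r - (q + 1) < r := by omega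
      refine RegLE.monIdeal_of_regular e hπ (hW _) (hW (r - q)) (hUV.trans (hVW _))
        (Sum.inl ⟨r - (q + 1), hq'⟩) ?_ ?_ ih
      · classical
        have hne : ∀ (u : Fin r ⊕ C →₀ ℕ) (c : C),
            (u + Finsupp.single (Sum.inl ⟨r - (q + 1), hq'⟩) 1 : Fin r ⊕ C →₀ ℕ) (Sum.inr c) =
              u (Sum.inr c) := by
          intro u c; simp
        rintro u ((⟨c, c', h⟩ | ⟨c, h⟩) | ⟨l, hl, h⟩)
        · rw [hne, hne] at h; exact Or.inl (Or.inl ⟨c, c', h⟩)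
        · rw [hne] at h; exact Or.inl (Or.inr ⟨c, h⟩)
        · refine Or.inr ⟨l, hl, ?_⟩
          rwa [Finsupp.add_apply, Finsupp.single_eq_of_ne, add_zero] at h
          intro h'
          rw [Sum.inl.injEq] at h'
          rw [h'] at hl
          exact lt_irrefl _ hl
      · intro u
        constructor
        · rintro (h | ⟨l, hl, h⟩)
          · exact Or.inl (Or.inl h)
          · rcases Nat.lt_or_ge l.1 (r - (q + 1)) with h' | h'
            · exact Or.inl (Or.inr ⟨l, h', h⟩)
            · obtain rfl : l = ⟨r - (q + 1), hq'⟩ := Fin.ext (by simp only; omega)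
              exact Or.inr h
        · rintro ((h | ⟨l, hl, h⟩) | h)
          · exact Or.inl h
          · exact Or.inr ⟨l, by omega, h⟩
          · exact Or.inr ⟨_, by simp only; omega, h⟩
  have hr := hreg r
  -- Finally the part of the chains from exponent `p c` on is restored; by `hpQ` it lives in degrees
  -- at most `b`.
  refine RegLE.monIdeal_of_subset e hπ hV (hW _) hUV (hVW _) (fun u hu hb => ?_) hr
  by_cases h2 : ∃ c c', c ≠ c' ∧ u (Sum.inr c) ≠ 0 ∧ u (Sum.inr c') ≠ 0
  · exact Or.inl h2
  rcases hu with (h | ⟨c, h⟩) | ⟨l, hl, -⟩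
  · exact absurd h h2
  · have hc : u (Sum.inr c) ≠ 0 := by have := hp0 c; omega
    have := degree_eq_of_not_two h2 hc
    exact Or.inr ⟨c, hpQ _ _ _ h (by omega)⟩
  · omega

variable (π) in
/-- The ideal generated by the `d`-th powers of the variables `x_c`, `c ∈ A`. -/
def powIdeal (A : Set C) (d : ℕ) : Ideal R :=
  Ideal.span ((fun c => π (X (Sum.inr c) ^ d)) '' A)

/-- Products of different `x_c` vanish, so only the pure powers `x_c ^ (d n)` of the generators
count. Nonemptiness of `A` is what makes the case `n = 0` the unit ideal. -/
theorem powIdeal_pow {P : C → ℕ → ℕ → Prop} (hπ : IsMonPresentation π (chainSet r P))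
    (hPm : ∀ c i i' t t', i ≤ i' → t ≤ t' → P c i t → P c i' t')
    {A : Set C} (hA : A.Nonempty) {d : ℕ} (hd : 0 < d) (n : ℕ)
    (hV : IsUpperSet (chainSet r fun c i t => P c i t ∨ (c ∈ A ∧ d * n ≤ i))) :
    powIdeal π A d ^ n = monIdeal π hV := by
  classical
  have hP : ∀ n, chainSet r P ⊆ chainSet r fun c i t => P c i t ∨ (c ∈ A ∧ d * n ≤ i) :=
    fun n => chainSet_mono fun _ _ _ h => Or.inl h
  have hVn : ∀ n, IsUpperSet (chainSet r fun c i t => P c i t ∨ (c ∈ A ∧ d * n ≤ i)) := fun n =>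
    isUpperSet_chainSet fun c i i' t t' hi ht h =>
      h.imp (hPm c i i' t t' hi ht) fun h => ⟨h.1, h.2.trans hi⟩
  have key : ∀ n, powIdeal π A d ^ n ≤ monIdeal π (hVn n) := by
    intro n
    induction n with
    | zero =>
      intro a _
      obtain ⟨p, rfl⟩ := hπ.surjective a
      obtain ⟨c, hc⟩ := hA
      exact (hπ.map_mem_monIdeal _ (hP 0)).mpr fun u _ => Or.inr ⟨c, Or.inr ⟨hc, by simp⟩⟩
    | succ n ih =>
      rw [pow_succ, Ideal.mul_le]
      intro a ha b hb
      have hp := ih ha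
      obtain ⟨p, rfl⟩ := hπ.surjective a
      rw [hπ.map_mem_monIdeal _ (hP n)] at hp
      refine Submodule.span_induction (p := fun b _ => π p * b ∈ monIdeal π (hVn (n + 1)))
        ?_ ?_ ?_ ?_ hb
      · rintro _ ⟨c, hc, rfl⟩
        rw [← map_mul, hπ.map_mem_monIdeal _ (hP (n + 1))]
        intro u hu
        rw [X_pow_eq_monomial, coeff_mul_monomial'] at hu
        split_ifs at hu with hle
        swap
        · exact absurd rfl hu
        rw [mul_one] at hu
        have hv := hp _ hu
        obtain ⟨v, rfl⟩ := exists_add_of_le hle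
        rw [add_tsub_cancel_left] at hv
        have h1 : ∀ c', v (Sum.inr c') ≤
            (Finsupp.single (Sum.inr c : Fin r ⊕ C) d + v) (Sum.inr c') := fun c' => by simp
        have h2 : (Finsupp.single (Sum.inr c : Fin r ⊕ C) d + v) (Sum.inr c) =
            d + v (Sum.inr c) := by simp
        rcases hv with ⟨c₁, c₂, hne, e1, e2⟩ | ⟨c', h | ⟨hc', h⟩⟩
        · have := h1 c₁
          have := h1 c₂
          exact Or.inl ⟨c₁, c₂, hne, by omega, by omega⟩
        · exact hP (n + 1) (isUpperSet_chainSet hPm le_add_self (Or.inr ⟨c', h⟩))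
        · by_cases hcc : c' = c
          · subst hcc
            exact Or.inr ⟨c', Or.inr ⟨hc', by rw [h2]; linarith [mul_add d n 1]⟩⟩
          -- For `n = 0` the exponent of `x_c'` may be zero, so there is no mixed product; the new
          -- factor `x_c ^ d` suffices then.
          · rcases Nat.eq_zero_or_pos n with rfl | hn
            · exact Or.inr ⟨c, Or.inr ⟨hc, by rw [h2]; omega⟩⟩
            · have := h1 c'
              have : 0 < d * n := Nat.mul_pos hd hn
              exact Or.inl ⟨c', c, hcc, by omega, by rw [h2]; omega⟩
      · rw [mul_zero]; exact zero_mem _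
      · intro b b' _ _ h h'
        rw [mul_add (π p)]; exact add_mem h h'
      · intro a b _ h
        rw [smul_eq_mul, mul_left_comm]; exact Ideal.mul_mem_left _ _ h
  refine le_antisymm (key n) ?_
  · intro a ha
    obtain ⟨p, rfl⟩ := hπ.surjective a
    rw [hπ.map_mem_monIdeal hV (hP n)] at ha
    rw [p.as_sum, map_sum]
    refine Ideal.sum_mem _ fun u hu => ?_
    by_cases h0 : u ∈ chainSet r P
    · rw [(hπ.eq_zero_iff _).mpr fun v hv => coeff_monomial_ne_zero hv ▸ h0]
      exact zero_mem _
    rcases ha u (mem_support_iff.mp hu) with h | ⟨c, h | ⟨hc, h⟩⟩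
    · exact absurd (Or.inl h) h0
    · exact absurd (Or.inr ⟨c, h⟩) h0
    · obtain ⟨v, hv⟩ := exists_add_of_le
        ((Finsupp.single_le_iff (i := Sum.inr c) (f := u)).mpr h)
      have e1 : monomial u (coeff u p) =
          (X (Sum.inr c) ^ d) ^ n * monomial v (coeff u p) := by
        rw [← pow_mul, X_pow_eq_monomial, monomial_mul, one_mul, ← hv]
      have hg : π (X (Sum.inr c) ^ d) ∈ powIdeal π A d :=
        Ideal.subset_span (Set.mem_image_of_mem _ hc)
      rw [e1, map_mul, map_pow π (X (Sum.inr c) ^ d)]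
      exact Ideal.mul_mem_right _ _ (Ideal.pow_mem_pow hg n)

/-- Pure powers of the `x_c` being zero, the quotient has the dimension of `k[y]`. -/
theorem ringKrullDim_quotient_chainSet (hπ : IsMonPresentation π U) {Q : C → ℕ → ℕ → Prop}
    (hV : IsUpperSet (chainSet r Q)) (hUV : U ⊆ chainSet r Q) (hQ0 : ∀ c t, ¬ Q c 0 t)
    (hQ : ∀ c, ∃ i, ∀ t, Q c i t) : ringKrullDim (R ⧸ monIdeal π hV) = r := by
  let ψ : MvPolynomial (Fin r ⊕ C) k →ₐ[k] R ⧸ monIdeal π hV :=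
    (Ideal.Quotient.mkₐ k (monIdeal π hV)).comp π
  have hψ : Function.Surjective ψ := (Ideal.Quotient.mkₐ_surjective k _).comp hπ.surjective
  have hψ0 : ∀ p, ψ p = 0 ↔ ∀ u, coeff u p ≠ 0 → u ∈ chainSet r Q := fun p =>
    Ideal.Quotient.eq_zero_iff_mem.trans (hπ.map_mem_monIdeal hV hUV)
  let φ : MvPolynomial (Fin r ⊕ C) k →ₐ[k] MvPolynomial (Fin r) k :=
    aeval (Sum.elim X fun _ => 0)
  have hφr : ∀ q, φ (rename Sum.inl q) = q := by
    intro q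
    rw [show φ (rename Sum.inl q) = (φ.comp (rename Sum.inl)) q from rfl,
      show φ.comp (rename Sum.inl) = AlgHom.id k _ from MvPolynomial.algHom_ext fun l => by
        simp [φ]]
    rfl
  have hker : RingHom.ker ψ.toRingHom ≤ RingHom.ker φ.toRingHom := by
    intro p hp
    have hp' := (hψ0 p).mp hp
    change φ p = 0
    rw [p.as_sum, map_sum]
    refine Finset.sum_eq_zero fun u hu => ?_
    obtain ⟨c, hc⟩ : ∃ c, u (Sum.inr c) ≠ 0 := by
      rcases hp' u (mem_support_iff.mp hu) with ⟨c, _, _, h, _⟩ | ⟨c, h⟩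
      · exact ⟨c, h⟩
      · exact ⟨c, fun h0 => hQ0 c _ (h0 ▸ h)⟩
    rw [aeval_monomial, Finsupp.prod,
      Finset.prod_eq_zero (Finsupp.mem_support_iff.mpr hc), mul_zero]
    simp [hc]
  let f : R ⧸ monIdeal π hV →+* MvPolynomial (Fin r) k :=
    RingHom.liftOfSurjective ψ.toRingHom hψ ⟨φ.toRingHom, hker⟩
  have hf : ∀ p, f (ψ p) = φ p := fun p =>
    RingHom.liftOfRightInverse_comp_apply ψ.toRingHom _ _ ⟨φ.toRingHom, hker⟩ p
  rw [ringKrullDim_eq_of_ker_le_nilradical f (fun q => ⟨ψ (rename Sum.inl q), by rw [hf, hφr]⟩)]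
  · rw [MvPolynomial.ringKrullDim_of_isNoetherianRing, ringKrullDim_eq_zero_of_field]
    simp
  · intro b hb
    obtain ⟨p, rfl⟩ := hψ b
    have hp : φ p = 0 := by rw [← hf]; exact hb
    let ν : R ⧸ monIdeal π hV →ₐ[k] (R ⧸ monIdeal π hV) ⧸ nilradical (R ⧸ monIdeal π hV) :=
      Ideal.Quotient.mkₐ k _
    -- Modulo the nilradical every `x_c` is zero, so the class of `p` depends only on `φ p`, where
    -- `φ` sets the `x_c` to zero.
    have hcomp : ν.comp ψ = (ν.comp ψ).comp ((rename Sum.inl).comp φ) := by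
      refine MvPolynomial.algHom_ext fun i => ?_
      rcases i with l | c
      · simp [φ]
      · have h0 : ψ (X (Sum.inr c)) ∈ nilradical (R ⧸ monIdeal π hV) := by
          obtain ⟨i, hi⟩ := hQ c
          refine mem_nilradical.mpr ⟨i, ?_⟩
          rw [← map_pow, hψ0]
          intro u hu
          rw [X_pow_eq_monomial] at hu
          rw [coeff_monomial_ne_zero hu]
          refine Or.inr ⟨c, ?_⟩
          rw [Finsupp.single_eq_same]
          exact hi _
        have h1 : ν (ψ (X (Sum.inr c))) = 0 := Ideal.Quotient.eq_zero_iff_mem.mpr h0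
        simp [φ, h1]
    have h2 := AlgHom.congr_fun hcomp p
    simp only [AlgHom.comp_apply, hp, map_zero] at h2
    exact Ideal.Quotient.eq_zero_iff_mem.mp h2

theorem exists_socle_class (hπ : IsMonPresentation π U) {V : Set (Fin r ⊕ C →₀ ℕ)}
    (hV : IsUpperSet V) (hUV : U ⊆ V) {u : Fin r ⊕ C →₀ ℕ} (hu : u ∉ V)
    (h : ∀ i, u + Finsupp.single i 1 ∈ V) :
    ∃ c ∈ localCohomologyPiece (monVar π e) (quotientGrading (monGrading π) (monIdeal π hV)) 0
      (u.degree : ℤ), c ≠ 0 := by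
  refine exists_ne_zero_of_socle (monVar π e)
    (m := Ideal.Quotient.mk (monIdeal π hV) (π (monomial u 1))) ?_ ?_ ?_
  · exact mem_quotientGrading_natCast.mpr
      ⟨_, map_mem_monGrading (isHomogeneous_monomial _ rfl), rfl⟩
  · rw [Ne, Ideal.Quotient.eq_zero_iff_mem, hπ.map_monomial_mem_monIdeal hV hUV]
    exact hu
  · intro l
    change Ideal.Quotient.mk (monIdeal π hV) (π (X (e l)) * π (monomial u 1)) = 0
    rw [Ideal.Quotient.eq_zero_iff_mem, ← map_mul, X, monomial_mul, one_mul,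
      hπ.map_monomial_mem_monIdeal hV hUV, add_comm]
    exact h _

/-- The class is that of `1 / (y_1 ⋯ y_r)`: the `x_c` are nilpotent by `h`, and by `h0` no monomial
in the `y_l` alone is killed. -/
theorem exists_top_class (hπ : IsMonPresentation π U) {V : Set (Fin r ⊕ C →₀ ℕ)}
    (hV : IsUpperSet V) (hUV : U ⊆ V) (hr : 0 < r)
    (h0 : ∀ u ∈ V, ∃ c, u (Sum.inr c) ≠ 0)
    (h : ∀ c, ∃ i : ℕ, Finsupp.single (Sum.inr c) i ∈ V) :
    ∃ c ∈ localCohomologyPiece (monVar π e) (quotientGrading (monGrading π) (monIdeal π hV)) r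
      (-r : ℤ), c ≠ 0 := by
  classical
  obtain ⟨i, rfl⟩ : ∃ i, r = i + 1 := ⟨r - 1, by omega⟩
  let ι : Fin (i + 1) ↪ Fin s := ⟨fun l => e.symm (Sum.inl l), fun l l' h => by simpa using h⟩
  have hι : ∀ l, e (ι l) = Sum.inl l := fun l => e.apply_symm_apply _
  have := monGrading_gradedMonoid π
  have key := exists_ne_zero_of_top (monVar π e) (T₀ := Finset.univ.map ι) (i := i)
    (𝓜 := quotientGrading (monGrading π) (monIdeal π hV)) (j := 0)
    (m := Ideal.Quotient.mk (monIdeal π hV) 1) (by simp)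
    (mem_quotientGrading_natCast (n := 0).mpr ⟨1, SetLike.GradedOne.one_mem, rfl⟩) ?_ ?_
  · convert key using 6
    push_cast; ring
  · intro l hl
    obtain ⟨c, hc⟩ : ∃ c, e l = Sum.inr c := by
      rcases hel : e l with l' | c
      · exact absurd (Finset.mem_map.mpr ⟨l', Finset.mem_univ _, e.injective (by rw [hι, hel])⟩) hl
      · exact ⟨c, rfl⟩
    obtain ⟨t, ht⟩ := h c
    refine ⟨t, fun m => ?_⟩
    obtain ⟨a, rfl⟩ := Ideal.Quotient.mk_surjective m
    change Ideal.Quotient.mk (monIdeal π hV) (monVar π e l ^ t * a) = 0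
    rw [Ideal.Quotient.eq_zero_iff_mem]
    refine Ideal.mul_mem_right _ _ ?_
    rw [monVar, hc, ← map_pow, X_pow_eq_monomial, hπ.map_monomial_mem_monIdeal hV hUV]
    exact ht
  · intro t w hw
    have hw' : ∀ l, ∃ q, Ideal.Quotient.mk (monIdeal π hV) (π q) = w l := fun l => by
      obtain ⟨a, ha⟩ := Ideal.Quotient.mk_surjective (w l)
      obtain ⟨q, hq⟩ := hπ.surjective a
      exact ⟨q, by rw [hq, ha]⟩
    choose q hq using hw'
    have e1 : cechProd (monVar π e) (Finset.univ.map ι) =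
        π (∏ l : Fin (i + 1), X (Sum.inl l)) := by
      rw [cechProd, Finset.prod_map, map_prod]
      refine Finset.prod_congr rfl fun l _ => ?_
      rw [monVar, hι]
    have e2 : ∑ l ∈ Finset.univ.map ι, monVar π e l ^ (t + 1) • w l =
        Ideal.Quotient.mk (monIdeal π hV)
          (π (∑ l : Fin (i + 1), X (Sum.inl l) ^ (t + 1) * q (ι l))) := by
      rw [Finset.sum_map, map_sum, map_sum]
      refine Finset.sum_congr rfl fun l _ => ?_
      rw [← hq, map_mul, map_pow]
      have : monVar π e (ι l) = π (X (Sum.inl l)) := by rw [monVar, hι]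
      rw [this]
      rfl
    rw [e2, e1, ← map_pow] at hw
    have hw2 : Ideal.Quotient.mk (monIdeal π hV) (π ((∏ l : Fin (i + 1), X (Sum.inl l)) ^ t)) =
        Ideal.Quotient.mk (monIdeal π hV)
          (π (∑ l : Fin (i + 1), X (Sum.inl l) ^ (t + 1) * q (ι l))) := by
      rw [← hw, map_one]
      exact (mul_one (Ideal.Quotient.mk (monIdeal π hV) _)).symm
    rw [Ideal.Quotient.eq, ← map_sub, hπ.map_mem_monIdeal hV hUV] at hw2
    -- The monomial `(y_1 ⋯ y_r) ^ t` is divisible by no `y_l ^ (t + 1)`, so its coefficient in the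
    -- difference is `1`; thus it would have to lie in `V`, contrary to `h0`.
    let v : Fin (i + 1) ⊕ C →₀ ℕ := ∑ l : Fin (i + 1), Finsupp.single (Sum.inl l) t
    have hv : ∀ l, v (Sum.inl l) = t := by
      intro l
      simp [v, Finsupp.finsetSum_apply, Finsupp.single_apply]
    have hvc : ∀ c, v (Sum.inr c) = 0 := by
      intro c
      simp [v, Finsupp.finsetSum_apply]
    have e3 : ((∏ l : Fin (i + 1), X (Sum.inl l)) ^ t : MvPolynomial (Fin (i + 1) ⊕ C) k) =
        monomial v 1 := by
      rw [← Finset.prod_pow]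
      simp only [X_pow_eq_monomial, v]
      rw [monomial_sum_one]
    have hcoeff : coeff v (((∏ l : Fin (i + 1), X (Sum.inl l)) ^ t -
        ∑ l : Fin (i + 1), X (Sum.inl l) ^ (t + 1) * q (ι l) :
          MvPolynomial (Fin (i + 1) ⊕ C) k)) = 1 := by
      rw [coeff_sub, e3, coeff_monomial, if_pos rfl, coeff_sum, Finset.sum_eq_zero, sub_zero]
      intro l _
      rw [X_pow_eq_monomial, coeff_monomial_mul', if_neg]
      rw [Finsupp.single_le_iff, hv]
      omega
    obtain ⟨c, hc⟩ := h0 v (hw2 v (by rw [hcoeff]; exact one_ne_zero))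
    exact hc (hvc c)

end Chains

/-! ### The ring with prescribed regularities -/

section Construction

/-- The monomial relations of the ring with prescribed regularities `F n = d n + a n - 1`.  The
chain `0` realizes `F 1`, the chain `c` with `0 < c < N` realizes `F (c + 1)`, and the chain `N`
realizes all `F n` with `n > N`. -/
def chainRel (d N : ℕ) (F a : ℕ → ℕ) (c : Fin (N + 1)) (i t : ℕ) : Prop :=
  if c = 0 then (1 ≤ i ∧ 1 ≤ t) ∨ F 1 < i
  else (d * (c.1 + 1) ≤ i + 1 ∧ a (c.1 + 1) < t) ∨ (c.1 < N ∧ d * (c.1 + 1) ≤ i)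

/-- The monomial relations modulo the `n`-th power of the ideal generated by the `x_c ^ d`,
`c ≠ 0`. -/
def chainPowRel (d N : ℕ) (F a : ℕ → ℕ) (n : ℕ) (c : Fin (N + 1)) (i t : ℕ) : Prop :=
  chainRel d N F a c i t ∨ (c ∈ {c : Fin (N + 1) | c ≠ 0} ∧ d * n ≤ i)

variable {d N : ℕ} {F a : ℕ → ℕ}

theorem chainRel_mono (c : Fin (N + 1)) (i i' t t' : ℕ) (hi : i ≤ i') (ht : t ≤ t')
    (h : chainRel d N F a c i t) : chainRel d N F a c i' t' := by
  unfold chainRel at h ⊢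
  split_ifs at h ⊢ <;> omega

theorem chainPowRel_mono (n : ℕ) (c : Fin (N + 1)) (i i' t t' : ℕ) (hi : i ≤ i') (ht : t ≤ t')
    (h : chainPowRel d N F a n c i t) : chainPowRel d N F a n c i' t' :=
  h.imp (chainRel_mono c i i' t t' hi ht) fun h => ⟨h.1, h.2.trans hi⟩

theorem chainPowRel_zero_iff {n i t : ℕ} :
    chainPowRel d N F a n 0 i t ↔ (1 ≤ i ∧ 1 ≤ t) ∨ F 1 < i := by
  simp [chainPowRel, chainRel]

theorem chainPowRel_iff_of_ne {n i t : ℕ} {c : Fin (N + 1)} (hc : c ≠ 0) :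
    chainPowRel d N F a n c i t ↔ (d * (c.1 + 1) ≤ i + 1 ∧ a (c.1 + 1) < t) ∨
      (c.1 < N ∧ d * (c.1 + 1) ≤ i) ∨ d * n ≤ i := by
  simp [chainPowRel, chainRel, hc, or_assoc]

/-- No relation touches `k[y]`, because `d (c + 1) - 1 ≥ 2 d - 1 > 0` for `c ≠ 0`. A chain of this
shape for `F 1` would start at exponent `d - 1`, which is zero when `d = 1`; hence the separate
chain `0`. -/
theorem not_chainPowRel_exponent_zero (hd : 0 < d) {n : ℕ} (hn : 0 < n) (c : Fin (N + 1)) (t : ℕ) :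
    ¬ chainPowRel d N F a n c 0 t := by
  by_cases hc : c = 0
  · subst hc; rw [chainPowRel_zero_iff]; omega
  · rw [chainPowRel_iff_of_ne hc]
    have h1 : 0 < d * n := Nat.mul_pos hd hn
    have h2 : 0 < c.1 := Nat.pos_of_ne_zero fun h => hc (Fin.ext h)
    have h3 : d * 2 ≤ d * (c.1 + 1) := Nat.mul_le_mul_left d (by omega)
    omega

theorem exists_chainPowRel_exponent (n : ℕ) (c : Fin (N + 1)) :
    ∃ i, ∀ t, chainPowRel d N F a n c i t := by
  by_cases hc : c = 0
  · subst hc; exact ⟨F 1 + 1, fun t => chainPowRel_zero_iff.mpr (by omega)⟩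
  · exact ⟨d * n, fun t => (chainPowRel_iff_of_ne hc).mpr (by omega)⟩

variable {r : ℕ}

theorem sum_add_single_inl {C : Type} (u : Fin r ⊕ C →₀ ℕ) (l : Fin r) (y : ℕ) :
    ∑ l', (u + Finsupp.single (Sum.inl l) y : Fin r ⊕ C →₀ ℕ) (Sum.inl l') =
      ∑ l', u (Sum.inl l') + y := by
  classical
  simp [Finset.sum_add_distrib, Finsupp.single_apply]

theorem sum_add_single_inr {C : Type} (u : Fin r ⊕ C →₀ ℕ) (c : C) (y : ℕ) :
    ∑ l', (u + Finsupp.single (Sum.inr c) y : Fin r ⊕ C →₀ ℕ) (Sum.inl l') =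
      ∑ l', u (Sum.inl l') := by
  classical
  simp

/-- The exponent of the monomial `x_c ^ i * y_l ^ t`. -/
def socleExp {C : Type} (c : C) (i : ℕ) (l : Fin r) (t : ℕ) : Fin r ⊕ C →₀ ℕ :=
  Finsupp.single (Sum.inr c) i + Finsupp.single (Sum.inl l) t

theorem sum_socleExp {C : Type} (c : C) (i : ℕ) (l : Fin r) (t : ℕ) :
    ∑ l', socleExp c i l t (Sum.inl l') = t := by
  rw [socleExp, sum_add_single_inl]
  simp

theorem degree_socleExp {C : Type} (c : C) (i : ℕ) (l : Fin r) (t : ℕ) :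
    (socleExp c i l t).degree = i + t := by
  simp [socleExp]

theorem socleExp_inr_self {C : Type} (c : C) (i : ℕ) (l : Fin r) (t : ℕ) :
    socleExp c i l t (Sum.inr c) = i := by
  simp [socleExp]

theorem socleExp_inr_of_ne {C : Type} {c c' : C} (h : c' ≠ c) (i : ℕ) (l : Fin r) (t : ℕ) :
    socleExp c i l t (Sum.inr c') = 0 := by
  classical
  simp [socleExp, h.symm]

theorem socleExp_notMem {C : Type} {Q : C → ℕ → ℕ → Prop} (hQ : ∀ c t, ¬ Q c 0 t) {c : C} {i : ℕ}
    (l : Fin r) {t : ℕ} (h : ¬ Q c i t) : socleExp c i l t ∉ chainSet r Q := by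
  rintro (⟨c₁, c₂, hne, h₁, h₂⟩ | ⟨c', h'⟩)
  · have e₁ : c₁ = c := by by_contra h'; exact h₁ (socleExp_inr_of_ne h' i l t)
    have e₂ : c₂ = c := by by_contra h'; exact h₂ (socleExp_inr_of_ne h' i l t)
    exact hne (e₁.trans e₂.symm)
  · rw [sum_socleExp] at h'
    by_cases hc : c' = c
    · subst hc; rw [socleExp_inr_self] at h'; exact h h'
    · rw [socleExp_inr_of_ne hc] at h'; exact hQ _ _ h'

/-- As `i ≠ 0`, every other `x_c'` kills the monomial; only `x_c` and the `y_l` need the hypotheses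
on `Q`. -/
theorem socleExp_add_single_mem {C : Type} {Q : C → ℕ → ℕ → Prop} {c : C} {i : ℕ} (hi : i ≠ 0)
    (l : Fin r) {t : ℕ} (h₁ : Q c (i + 1) t) (h₂ : Q c i (t + 1)) (v : Fin r ⊕ C) :
    socleExp c i l t + Finsupp.single v 1 ∈ chainSet r Q := by
  classical
  rcases v with l' | c'
  · refine Or.inr ⟨c, ?_⟩
    rw [sum_add_single_inl, sum_socleExp, Finsupp.add_apply, socleExp_inr_self]
    simpa using h₂
  · by_cases hc : c' = c
    · subst hc
      refine Or.inr ⟨c', ?_⟩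
      rw [sum_add_single_inr, sum_socleExp, Finsupp.add_apply, socleExp_inr_self]
      simpa using h₁
    · refine Or.inl ⟨c, c', Ne.symm hc, ?_, ?_⟩
      · rw [Finsupp.add_apply, socleExp_inr_self]; omega
      · simp

open MvPolynomial in
/-- A function of the form `F n = d n + a n - 1` with `F` nondecreasing and `a` constant from
`N + 1` on is the regularity function of the powers of an ideal. -/
theorem isRegFunctionOfPowers_of_nat (k : Type u) [Field k] (hd : 0 < d) (hr : 0 < r)
    (hN : 0 < N) (hFa : ∀ n, 0 < n → F n + 1 = d * n + a n)
    (hF : ∀ m n, 0 < m → m ≤ n → F m ≤ F n) (ha : ∀ n, N < n → a n = a (N + 1)) {f : ℕ → ℤ}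
    (hf : ∀ n, 0 < n → f n = F n) : IsRegFunctionOfPowers k d r f := by
  have hU : IsUpperSet (chainSet r (chainRel d N F a)) := isUpperSet_chainSet chainRel_mono
  let J := restrictSupportIdeal k _ hU
  let π : MvPolynomial (Fin r ⊕ Fin (N + 1)) k →ₐ[k]
    MvPolynomial (Fin r ⊕ Fin (N + 1)) k ⧸ J := Ideal.Quotient.mkₐ k J
  have hπ : IsMonPresentation π (chainSet r (chainRel d N F a)) := isMonPresentation_mkₐ hU
  have hV : ∀ n, IsUpperSet (chainSet r (chainPowRel d N F a n)) := fun n =>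
    isUpperSet_chainSet (chainPowRel_mono n)
  have hUV : ∀ n, chainSet r (chainRel d N F a) ⊆ chainSet r (chainPowRel d N F a n) := fun n =>
    chainSet_mono fun _ _ _ h => Or.inl h
  have hlast : Fin.last N ≠ 0 := by
    intro h
    have := congrArg Fin.val h
    simp at this
    omega
  let A : Set (Fin (N + 1)) := {c | c ≠ 0}
  have hI : ∀ n, powIdeal π A d ^ n = monIdeal π (hV n) := fun n =>
    powIdeal_pow hπ chainRel_mono ⟨Fin.last N, hlast⟩ hd n (hV n)
  let e : Fin (r + (N + 1)) ≃ Fin r ⊕ Fin (N + 1) := finSumFinEquiv.symm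
  let _ : GradedAlgebra (monGrading π) := hπ.gradedAlgebra
  refine ⟨_, inferInstance, inferInstance, monGrading π, hπ.gradedAlgebra, r + (N + 1),
    monVar π e, powIdeal π A d, ⟨monVar_mem e, hπ.adjoin_range_monVar e⟩, ⟨_, ?_, rfl⟩, ?_, ?_, ?_⟩
  · rintro _ ⟨c, _, rfl⟩
    exact map_mem_monGrading (isHomogeneous_X_pow _ _)
  · intro n hn h
    rw [hI] at h
    -- The powers of `I` are nonzero because `x_N`, the variable of the unbounded chain, is not
    -- nilpotent in `R`.
    have h1 : π (monomial (Finsupp.single (Sum.inr (Fin.last N)) (d * n)) 1) ∈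
        monIdeal π (hV n) := by
      rw [hπ.map_monomial_mem_monIdeal _ (hUV n)]
      refine Or.inr ⟨Fin.last N, Or.inr ⟨hlast, ?_⟩⟩
      simp
    rw [h, Ideal.mem_bot, hπ.eq_zero_iff] at h1
    classical
    rcases h1 _ (by rw [coeff_monomial, if_pos rfl]; exact one_ne_zero) with
      ⟨c, c', hne, h₁, h₂⟩ | ⟨c, h⟩
    · rw [Finsupp.single_apply_ne_zero] at h₁ h₂
      exact hne (Sum.inr_injective (h₁.1.trans h₂.1.symm))
    · have hy : ∑ l : Fin r, (Finsupp.single (Sum.inr (Fin.last N)) (d * n) :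
          Fin r ⊕ Fin (N + 1) →₀ ℕ) (Sum.inl l) = 0 := by simp
      rw [hy] at h
      by_cases hc : c = Fin.last N
      · subst hc
        rw [chainRel, if_neg hlast] at h
        simp at h
      · rw [Finsupp.single_eq_of_ne (fun h => hc (Sum.inr_injective h))] at h
        exact not_chainPowRel_exponent_zero hd hn c 0 (Or.inl h)
  · have h1 := hI 1
    rw [pow_one] at h1
    rw [h1]
    exact ringKrullDim_quotient_chainSet hπ (hV 1) (hUV 1)
      (not_chainPowRel_exponent_zero hd one_pos) (exists_chainPowRel_exponent 1)
  · intro n hn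
    have hFn := hFa n hn
    rw [hI, hf n hn]
    have hreg : RegLE (monVar π e) (quotientGrading (monGrading π) (monIdeal π (hV n))) (F n) := by
      -- Each chain is free up to the first exponent with a relation: `1` for the chain `0`,
      -- otherwise its first truncated layer `d (c + 1) - 1` or the cut `d n` by `I ^ n`, whichever
      -- comes first.
      refine regLE_chainSet e hπ (hV n) (hUV n)
        (fun c => if c = 0 then 1 else min (d * (c.1 + 1) - 1) (d * n)) ?_ ?_ ?_ ?_
      all_goals
        intro c
        by_cases hc : c = 0
      · subst hc; simp
      · have h1 : 0 < d * n := Nat.mul_pos hd hn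
        have h2 : 0 < c.1 := Nat.pos_of_ne_zero fun h => hc (Fin.ext h)
        have h3 : d * 2 ≤ d * (c.1 + 1) := Nat.mul_le_mul_left d (by omega)
        simp only [if_neg hc]
        omega
      · subst hc; simp
      · simp only [if_neg hc]
        omega
      · subst hc
        intro i t h
        rw [chainPowRel_zero_iff] at h
        simp only [if_true]
        omega
      · intro i t h
        rw [chainPowRel_iff_of_ne hc] at h
        simp only [if_neg hc]
        omega
      · subst hc
        intro i t h h'
        rw [chainPowRel_zero_iff]
        have := hF 1 n one_pos hn
        simp only [if_true] at h
        omega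
      · intro i t h h'
        rw [chainPowRel_iff_of_ne hc]
        simp only [if_neg hc] at h
        have h2 : 0 < c.1 := Nat.pos_of_ne_zero fun h => hc (Fin.ext h)
        -- If `n ≤ c`, the cut at `d n` precedes the truncated layer. Otherwise, for `c < N` there
        -- is one truncated layer, of top degree `F (c + 1) ≤ F n`; for `c = N` there are layers up
        -- to exponent `d n - 1`, and `a (N + 1) = a n`.
        rcases Nat.lt_or_ge n (c.1 + 1) with hlt | hge
        · have : d * (n + 1) ≤ d * (c.1 + 1) := Nat.mul_le_mul_left d (by omega)
          rw [mul_add] at this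
          omega
        · have h3 := hFa (c.1 + 1) (by omega)
          have h4 := hF (c.1 + 1) n (by omega) hge
          have h5 : d * (c.1 + 1) ≤ d * n := Nat.mul_le_mul_left d hge
          rcases Nat.lt_or_ge c.1 N with hcN | hcN
          · omega
          · have hcN' : c.1 = N := le_antisymm (Nat.lt_succ_iff.mp c.2) hcN
            have h6 := ha n (by omega)
            rw [← hcN'] at h6
            omega
    let l₀ : Fin r := ⟨0, hr⟩
    have hQ0 := not_chainPowRel_exponent_zero (N := N) (F := F) (a := a) hd hn
    rcases Nat.lt_or_ge 1 n with hn1 | hn1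
    · let c : Fin (N + 1) := ⟨min (n - 1) N, by omega⟩
      have hc : c ≠ 0 := fun h => by
        have := congrArg Fin.val h
        simp [c] at this
        omega
      have hac : a (c.1 + 1) = a n := by
        rcases Nat.lt_or_ge N n with h | h
        · rw [ha n h, show c.1 = N by simp only [c]; omega]
        · rw [show c.1 + 1 = n by simp only [c]; omega]
      have hcn : d * (c.1 + 1) ≤ d * n := Nat.mul_le_mul_left d (by simp only [c]; omega)
      have hcN : c.1 < N → c.1 + 1 = n := by simp only [c]; omega
      have h2 : d * 2 ≤ d * n := Nat.mul_le_mul_left d hn1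
      refine IsRegularity.of_regLE hreg ?_ (exists_socle_class e hπ (hV n) (hUV n)
        (u := socleExp c (d * n - 1) l₀ (a n)) (socleExp_notMem hQ0 l₀ ?_)
        (socleExp_add_single_mem (by omega) l₀ ?_ ?_))
      · rw [degree_socleExp]; push_cast; omega
      · rw [chainPowRel_iff_of_ne hc, hac]
        rintro (h | ⟨h, h'⟩ | h)
        · omega
        · rw [hcN h] at h'; omega
        · omega
      · rw [chainPowRel_iff_of_ne hc]; omega
      · rw [chainPowRel_iff_of_ne hc, hac]; omega
    · obtain rfl : n = 1 := by omega
      -- For `F 1 > 0` the socle element is `x_0 ^ (F 1)`. For `F 1 = 0` this would be `1`, which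
      -- the `y_l` do not kill; the value `0 = -r + r` comes from `H^r` instead.
      rcases Nat.eq_zero_or_pos (F 1) with h0 | h0
      · refine IsRegularity.of_regLE hreg (i := r) (j := -r) (by rw [h0]; simp)
          (exists_top_class e hπ (hV 1) (hUV 1) hr ?_ ?_)
        · rintro u (⟨c, _, _, h, _⟩ | ⟨c, h⟩)
          · exact ⟨c, h⟩
          · exact ⟨c, fun h' => hQ0 c _ (h' ▸ h)⟩
        · intro c
          obtain ⟨i, hi⟩ := exists_chainPowRel_exponent (d := d) (F := F) (a := a) 1 c
          refine ⟨i, Or.inr ⟨c, ?_⟩⟩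
          rw [Finsupp.single_eq_same]
          exact hi _
      · refine IsRegularity.of_regLE hreg ?_ (exists_socle_class e hπ (hV 1) (hUV 1)
          (u := socleExp 0 (F 1) l₀ 0) (socleExp_notMem hQ0 l₀ ?_)
          (socleExp_add_single_mem (by omega) l₀ ?_ ?_))
        · rw [degree_socleExp]; simp
        · rw [chainPowRel_zero_iff]; omega
        · rw [chainPowRel_zero_iff]; omega
        · rw [chainPowRel_zero_iff]; omega

theorem isRegFunctionOfPowers_of_monotone (k : Type u) [Field k] (hd : 1 ≤ d) (hr : 1 ≤ r)
    {f : ℕ → ℤ} (hlim : ∃ e : ℤ, ∀ᶠ n : ℕ in atTop, f n = (d : ℤ) * (n : ℤ) + e)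
    (hlow : ∀ n : ℕ, 1 ≤ n → (d : ℤ) * (n : ℤ) - 1 ≤ f n)
    (hmono : ∀ n : ℕ, 1 ≤ n → f n ≤ f (n + 1)) : IsRegFunctionOfPowers k d r f := by
  obtain ⟨e, he⟩ := hlim
  obtain ⟨N, hN⟩ := eventually_atTop.mp he
  have hpos : ∀ n : ℕ, 1 ≤ n → 0 ≤ f n := fun n hn => by
    have h : 0 < d * n := Nat.mul_pos hd hn
    have h' : (1 : ℤ) ≤ (d : ℤ) * n := by exact_mod_cast h
    linarith [hlow n hn]
  have hcast : ∀ n : ℕ, 1 ≤ n → f n = ((f n).toNat : ℤ) := fun n hn =>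
    (Int.toNat_of_nonneg (hpos n hn)).symm
  have hmono' : ∀ m n : ℕ, 0 < m → m ≤ n → f m ≤ f n := fun m n hm hmn => by
    induction n, hmn using Nat.le_induction with
    | base => exact le_rfl
    | succ n hmn ih => exact ih.trans (hmono n (hm.trans_le hmn))
  -- Using `N + 1` guarantees a positive index for the last chain; `hlow` makes both truncations to
  -- `ℕ` lossless at `n ≥ 1`.
  refine isRegFunctionOfPowers_of_nat (N := N + 1) (F := fun n => (f n).toNat)
    (a := fun n => (f n - d * n + 1).toNat) k hd hr N.succ_pos (fun n hn => ?_)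
    (fun m n hm hmn => Int.toNat_le_toNat (hmono' m n hm hmn)) (fun n hn => ?_) hcast
  · have h1 := hcast n hn
    have h2 := Int.toNat_of_nonneg (show 0 ≤ f n - d * n + 1 by linarith [hlow n hn])
    zify
    rw [h2, ← h1]
    ring
  · rw [hN n (by omega), hN (N + 1 + 1) (by omega)]
    congr 1
    ring

end Construction

end GradedReg

end
theorem theorem2p6 (k : Type u) [Field k] (d : ℕ) (hd : 1 ≤ d) (r : ℕ) (hr : 1 ≤ r) :
    (∀ a : ℕ → ℕ, (∃ c : ℕ, Tendsto a atTop (𝓝 c)) →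
      (∀ n : ℕ, 1 ≤ n → (a n : ℤ) - (a (n + 1) : ℤ) ≤ (d : ℤ)) →
      GradedReg.IsRegFunctionOfPowers k d r
        (fun n => (d : ℤ) * (n : ℤ) + (a n : ℤ) - 1)) ∧
    (∀ f : ℕ → ℤ,
      (∃ e : ℤ, ∀ᶠ n : ℕ in atTop, f n = (d : ℤ) * (n : ℤ) + e) →
      (∀ n : ℕ, 1 ≤ n → (d : ℤ) * (n : ℤ) - 1 ≤ f n) →
      (∀ n : ℕ, 1 ≤ n → f n ≤ f (n + 1)) →
      GradedReg.IsRegFunctionOfPowers k d r f) := by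
  refine ⟨fun a ⟨c, hc⟩ ha => ?_,
    fun f h₁ h₂ h₃ => GradedReg.isRegFunctionOfPowers_of_monotone k hd hr h₁ h₂ h₃⟩
  -- In the discrete space `ℕ`, convergence means being eventually constant.
  rw [nhds_discrete, tendsto_pure] at hc
  refine GradedReg.isRegFunctionOfPowers_of_monotone k hd hr ⟨(c : ℤ) - 1, ?_⟩ (fun n _ => ?_)
    fun n hn => ?_
  · filter_upwards [hc] with n hn
    rw [hn]; ring
  · linarith [Int.natCast_nonneg (a n)]
  · have := ha n hn
    push_cast
    linarith
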